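/- Fix a constant $\delta\in(0,1)$ and put $k_0=\frac{2\log n}{\log(1/\delta)}$. The random simple temporal graph $(K_n,\lambda)$ is the complete graph on $n$ vertices whose edges carry independent labels $\lambda(e)$ uniform in $[0,1]$; a vertex set $Q$ is a $\delta$-temporal clique if $|\lambda(e)-\lambda(e')|\le\delta$ for all edges $e,e'$ inside $Q$. Algorithms are programs of a randomized real random access machine, with one step per elementary instruction or test. Suppose that for every constant $\delta'\in(0,1)$ the algorithm $\mathcal A(\delta')$, run on a random instance of $(K_n,\lambda)$, finds with probability at least $1-\exp(-\omega(n^2))$ a $\delta'$-temporal clique whose size is at least $(1-o(1))$ times the maximum size of a $\delta'$-temporal clique (the probability is over $\lambda$ and the random choices of the algorithm; the $o(1)$ and the $\omega(n^2)$ may depend on $\delta'$). Then $\mathcal A(\delta/2)$ can be used to find a clique of size $(1-o(1))k_0$ in the Erdős–Rényi graph $G_{n,\delta}$ with high probability, as follows. Given a graph $G$ on $n$ vertices, draw independent labels for all edges of $K_n$, uniform in $[0,\delta/2]$ for the edges of $G$ and uniform in $[\delta,1]$ for all other edges; run $\mathcal A(\delta/2)$ once on the resulting temporal graph; return the vertex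 set that it returns. The labels are produced by a program that depends only on $\delta$ and takes $O(n^2)$ steps; so, if $\mathcal A(\delta/2)$ takes at most $T(n)$ steps on every temporal graph on $K_n$ with labels in $[0,1]$, then the whole procedure takes at most $T(n)+O(n^2)$ steps on every graph with $n$ vertices. With probability tending to $1$ (over $G=G_{n,\delta}$ and all random choices) the returned set $Q$ is a clique of $G$ and $\bigl||Q|-k_0\bigr|\le o(1)\,k_0$. -/

import Mathlib

open MeasureTheory

/-! ### A randomized real random access machine -/

namespace RealRAM

/-- A configuration of the machine: integer and real registers, an integer and a real memory
(addressed indirectly through integer registers), and the random numbers not yet drawn. -/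
structure State where
  ireg : ℕ → ℕ
  rreg : ℕ → ℝ
  imem : ℕ → ℕ
  rmem : ℕ → ℝ
  tape : ℕ → ℝ

/-- Elementary instructions. The first argument of every instruction except the two `store`s is the
target register. -/
inductive Instr where
  | iconst (a c : ℕ)
  | iadd (a b c : ℕ)
  | isub (a b c : ℕ)
  | iload (a b : ℕ)
  | istore (a b : ℕ)
  | rconst (a : ℕ) (x : ℝ)
  | radd (a b c : ℕ)
  | rsub (a b c : ℕ)
  | rmul (a b c : ℕ)
  | rdiv (a b c : ℕ)
  | rload (a b : ℕ)
  | rstore (a b : ℕ)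
  | draw (a : ℕ)

/-- The effect of an elementary instruction. `load`s and `store`s address the memory by the content
of the integer register `b`, respectively `a`; `draw` takes the next number from the tape. -/
noncomputable def Instr.exec : Instr → State → State
  | iconst a c, s => { s with ireg := Function.update s.ireg a c }
  | iadd a b c, s => { s with ireg := Function.update s.ireg a (s.ireg b + s.ireg c) }
  | isub a b c, s => { s with ireg := Function.update s.ireg a (s.ireg b - s.ireg c) }
  | iload a b, s => { s with ireg := Function.update s.ireg a (s.imem (s.ireg b)) }
  | istore a b, s => { s with imem := Function.update s.imem (s.ireg a) (s.ireg b) }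
  | rconst a x, s => { s with rreg := Function.update s.rreg a x }
  | radd a b c, s => { s with rreg := Function.update s.rreg a (s.rreg b + s.rreg c) }
  | rsub a b c, s => { s with rreg := Function.update s.rreg a (s.rreg b - s.rreg c) }
  | rmul a b c, s => { s with rreg := Function.update s.rreg a (s.rreg b * s.rreg c) }
  | rdiv a b c, s => { s with rreg := Function.update s.rreg a (s.rreg b / s.rreg c) }
  | rload a b, s => { s with rreg := Function.update s.rreg a (s.rmem (s.ireg b)) }
  | rstore a b, s => { s with rmem := Function.update s.rmem (s.ireg a) (s.rreg b) }
  | draw a, s =>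
      { s with rreg := Function.update s.rreg a (s.tape 0), tape := fun k => s.tape (k + 1) }

/-- Branching conditions: comparison of two integer or two real registers. -/
inductive Test where
  | ilt (a b : ℕ)
  | rlt (a b : ℕ)

/-- When a branching condition is met. -/
def Test.Holds : Test → State → Prop
  | ilt a b, s => s.ireg a < s.ireg b
  | rlt a b, s => s.rreg a < s.rreg b

/-- Programs. A program is a finite object that does not depend on the input or its size. -/
inductive Program where
  | op (i : Instr)
  | seq (p q : Program)
  | ite (c : Test) (p q : Program)
  | loop (c : Test) (p : Program)

/-- `Exec p s s' t`: started in configuration `s`, the program `p` halts in configuration `s'` after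
exactly `t` steps. Every elementary instruction and every evaluation of a test is one step. -/
inductive Exec : Program → State → State → ℕ → Prop
  | op (i : Instr) (s : State) : Exec (.op i) s (i.exec s) 1
  | seq {p q : Program} {s s' s'' : State} {t t' : ℕ} :
      Exec p s s' t → Exec q s' s'' t' → Exec (.seq p q) s s'' (t + t')
  | ite_true {c : Test} {p q : Program} {s s' : State} {t : ℕ} :
      c.Holds s → Exec p s s' t → Exec (.ite c p q) s s' (t + 1)
  | ite_false {c : Test} {p q : Program} {s s' : State} {t : ℕ} :
      ¬ c.Holds s → Exec q s s' t → Exec (.ite c p q) s s' (t + 1)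
  | loop_true {c : Test} {p : Program} {s s' s'' : State} {t t' : ℕ} :
      c.Holds s → Exec p s s' t → Exec (.loop c p) s' s'' t' → Exec (.loop c p) s s'' (t + t' + 1)
  | loop_false {c : Test} {p : Program} {s : State} :
      ¬ c.Holds s → Exec (.loop c p) s s 1

/-- The final configuration and the number of steps are determined by the initial configuration. -/
theorem Exec.unique {p : Program} {s s₁ s₂ : State} {t₁ t₂ : ℕ}
    (h₁ : Exec p s s₁ t₁) (h₂ : Exec p s s₂ t₂) : s₁ = s₂ ∧ t₁ = t₂ := by
  induction h₁ generalizing s₂ t₂ with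
  | op i s => cases h₂; exact ⟨rfl, rfl⟩
  | seq _ _ ih ih' =>
    cases h₂ with
    | seq k k' =>
      obtain ⟨rfl, rfl⟩ := ih k
      obtain ⟨rfl, rfl⟩ := ih' k'
      exact ⟨rfl, rfl⟩
  | ite_true hc _ ih =>
    cases h₂ with
    | ite_true _ k => obtain ⟨rfl, rfl⟩ := ih k; exact ⟨rfl, rfl⟩
    | ite_false hn _ => exact absurd hc hn
  | ite_false hc _ ih =>
    cases h₂ with
    | ite_false _ k => obtain ⟨rfl, rfl⟩ := ih k; exact ⟨rfl, rfl⟩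
    | ite_true hn _ => exact absurd hn hc
  | loop_true hc _ _ ih ih' =>
    cases h₂ with
    | loop_true _ k k' =>
      obtain ⟨rfl, rfl⟩ := ih k
      obtain ⟨rfl, rfl⟩ := ih' k'
      exact ⟨rfl, rfl⟩
    | loop_false hn => exact absurd hc hn
  | loop_false hc =>
    cases h₂ with
    | loop_false _ => exact ⟨rfl, rfl⟩
    | loop_true hn _ _ => exact absurd hn hc

end RealRAM

namespace TemporalClique

open RealRAM

/-! ### Temporal cliques and the random models -/

/-- `Q` is a `δ`-temporal clique of the simple temporal graph `(G, lab)`: it is a clique of `G`, and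
the labels of any two edges inside `Q` differ by at most `δ`. -/
def IsTemporalClique {V : Type*} (G : SimpleGraph V) (lab : G.edgeSet → ℝ) (δ : ℝ)
    (Q : Finset V) : Prop :=
  G.IsClique (Q : Set V) ∧
    ∀ e e' : G.edgeSet, (∀ v ∈ (e : Sym2 V), v ∈ Q) → (∀ v ∈ (e' : Sym2 V), v ∈ Q) →
      |lab e - lab e'| ≤ δ

/-- The edges of the complete graph `K_n`. -/
abbrev Edge (n : ℕ) : Type := (⊤ : SimpleGraph (Fin n)).edgeSet

/-- The uniform distribution on `[0, 1]`. -/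
noncomputable def uniform01 : Measure ℝ := volume.restrict (Set.Icc 0 1)

instance : IsProbabilityMeasure uniform01 := ⟨by simp [uniform01]⟩

/-- The labels of the random simple temporal graph `(K_n, λ)`: independent and uniform. -/
noncomputable def labelMeasure (n : ℕ) : Measure (Edge n → ℝ) :=
  Measure.pi fun _ => uniform01

/-- The random numbers available to a program: an independent uniform sequence. -/
noncomputable def tapeMeasure : Measure (ℕ → ℝ) :=
  Measure.infinitePi fun _ => uniform01

/-- `k₀ = 2 log n / log (1 / δ)`. -/
noncomputable def k₀ (δ : ℝ) (n : ℕ) : ℝ := 2 * Real.log n / Real.log (1 / δ)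

/-! ### Inputs and outputs of programs -/

/-- The address of the edge `{j, i}`, `j < i`, is `i (i - 1) / 2 + j`; so the edges of `K_n` occupy
the addresses below `n (n - 1) / 2`. -/
def edgeIndex {n : ℕ} (e : Edge n) : ℕ :=
  ((e : Sym2 (Fin n)).sup : ℕ).choose 2 + ((e : Sym2 (Fin n)).inf : ℕ)

theorem choose_two_add_lt {n i j : ℕ} (h : j < i) (hi : i < n) : i.choose 2 + j < n.choose 2 := by
  have h1 : (i+1).choose 2 = i + i.choose 2 := by
    rw [Nat.choose_succ_succ' i 1]; simp
  have h2 : (i+1).choose 2 ≤ n.choose 2 := Nat.choose_le_choose 2 hi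
  omega

theorem edge_eq {n : ℕ} (e : Edge n) : ∃ i j : Fin n, j < i ∧ (e : Sym2 (Fin n)) = s(i,j) ∧ edgeIndex e = (i:ℕ).choose 2 + j := by
  obtain ⟨e, he⟩ := e
  induction e with
  | _ a b =>
    have hne : a ≠ b := by simpa using he
    rcases lt_or_gt_of_ne hne with h | h
    · exact ⟨b, a, h, Sym2.eq_swap, by simp [edgeIndex, h.le]⟩
    · exact ⟨a, b, h, rfl, by simp [edgeIndex, h.le]⟩

/-- Different edges have different addresses. -/
theorem edgeIndex_injective {n : ℕ} : Function.Injective (edgeIndex (n := n)) := by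
  intro e e' h
  obtain ⟨i, j, hij, he, hk⟩ := edge_eq e
  obtain ⟨i', j', hij', he', hk'⟩ := edge_eq e'
  have hii : (i:ℕ) = i' := by
    rcases lt_trichotomy (i:ℕ) i' with h1 | h1 | h1
    · have := choose_two_add_lt (show (j:ℕ) < i from hij) h1; omega
    · exact h1
    · have := choose_two_add_lt (show (j':ℕ) < i' from hij') h1; omega
  have hi : i = i' := Fin.ext hii
  subst hi
  have hj : j = j' := Fin.ext (by omega)
  subst hj
  exact Subtype.ext (he.trans he'.symm)

/-- The input `(K_n, lab)`: the number `n` in integer register `0` and the labels in the real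
memory; everything else is zero. -/
noncomputable def temporalInput {n : ℕ} (lab : Edge n → ℝ) (ω : ℕ → ℝ) : State where
  ireg := Function.update 0 0 n
  rreg := 0
  imem := 0
  rmem := Function.extend edgeIndex lab 0
  tape := ω

open Classical in
/-- The input of a graph `G` on `n` vertices: the number `n` in integer register `0` and the
adjacency bits in the integer memory; everything else is zero. -/
noncomputable def graphInput {n : ℕ} (G : SimpleGraph (Fin n)) (ω : ℕ → ℝ) : State where
  ireg := Function.update 0 0 n
  rreg := 0
  imem := Function.extend edgeIndex
    (fun e : Edge n => if (e : Sym2 (Fin n)) ∈ G.edgeSet then 1 else 0) 0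
  rmem := 0
  tape := ω

/-- The set of vertices returned in a final configuration, as a bit vector in the integer memory. -/
def output (n : ℕ) (s : State) : Finset (Fin n) :=
  Finset.univ.filter fun v => s.imem v = 1

/-- The program `p`, run on the temporal graph `(K_n, lab)`, halts and returns `Q`. -/
def TemporalReturns {n : ℕ} (p : Program) (lab : Edge n → ℝ) (ω : ℕ → ℝ) (Q : Finset (Fin n)) :
    Prop :=
  ∃ s t, Exec p (temporalInput lab ω) s t ∧ output n s = Q

/-- The program `p`, run on the graph `G`, halts and returns `Q`. -/
def GraphReturns {n : ℕ} (p : Program) (G : SimpleGraph (Fin n)) (ω : ℕ → ℝ) (Q : Finset (Fin n)) :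
    Prop :=
  ∃ s t, Exec p (graphInput G ω) s t ∧ output n s = Q

/-- The worst case running time of `p` on temporal graphs `(K_n, lab)` is at most `T n`. -/
def TemporalTime (p : Program) (T : ℕ → ℕ) : Prop :=
  ∀ (n : ℕ) (lab : Edge n → ℝ) (ω : ℕ → ℝ), (∀ e, lab e ∈ Set.Icc (0 : ℝ) 1) →
    (∀ k, ω k ∈ Set.Icc (0 : ℝ) 1) → ∃ s, ∃ t ≤ T n, Exec p (temporalInput lab ω) s t

/-- The worst case running time of `p` on graphs with `n` vertices is at most `T n`. -/
def GraphTime (p : Program) (T : ℕ → ℕ) : Prop :=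
  ∀ (n : ℕ) (G : SimpleGraph (Fin n)) (ω : ℕ → ℝ),
    (∀ k, ω k ∈ Set.Icc (0 : ℝ) 1) → ∃ s, ∃ t ≤ T n, Exec p (graphInput G ω) s t

/-! ### Success of an algorithm -/

/-- The returned set `Q` is a `(1 - ε)`-approximation of a maximum `δ`-temporal clique. -/
def IsApproxMax {n : ℕ} (lab : Edge n → ℝ) (δ ε : ℝ) (Q : Finset (Fin n)) : Prop :=
  IsTemporalClique ⊤ lab δ Q ∧
    ∀ Q' : Finset (Fin n), IsTemporalClique ⊤ lab δ Q' → (1 - ε) * (Q'.card : ℝ) ≤ Q.card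

/-- On a random instance of `(K_n, λ)`, the program `p` finds a `(1 - o(1))`-approximation of a
maximum `δ`-temporal clique with probability `1 - exp (-ω(n²))`. -/
def VeryLikelyApprox (p : Program) (δ : ℝ) : Prop :=
  ∃ ε f : ℕ → ℝ, Filter.Tendsto ε Filter.atTop (nhds 0) ∧
    Filter.Tendsto (fun n : ℕ => f n / (n : ℝ) ^ 2) Filter.atTop Filter.atTop ∧
    ∀ n : ℕ, ((labelMeasure n).prod tapeMeasure)
        {x | ¬ ∃ Q, TemporalReturns p x.1 x.2 Q ∧ IsApproxMax x.1 δ (ε n) Q} ≤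
      ENNReal.ofReal (Real.exp (-f n))

/-- On a random graph `G(n, δ)`, the program `p` finds with high probability a clique of size
`(1 - o(1)) k₀`. -/
def FindsCliqueWhp (p : Program) (δ : unitInterval) : Prop :=
  ∃ ε : ℕ → ℝ, Filter.Tendsto ε Filter.atTop (nhds 0) ∧
    Filter.Tendsto (fun n : ℕ => ((SimpleGraph.binomialRandom (Fin n) δ).prod tapeMeasure)
      {x | ¬ ∃ Q, GraphReturns p x.1 x.2 Q ∧ x.1.IsClique (Q : Set (Fin n)) ∧
        |(Q.card : ℝ) - k₀ δ n| ≤ ε n * k₀ δ n}) Filter.atTop (nhds 0)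

/-! ### The planted instance -/

open Classical in
/-- The labels planted from `G` and the random numbers `u`: `δ / 2 · u e`, uniform in `[0, δ / 2]`,
on the edges of `G`, and `δ + (1 - δ) · u e`, uniform in `[δ, 1]`, on all other edges of `K_n`. -/
noncomputable def plantedLabel {n : ℕ} (δ : ℝ) (G : SimpleGraph (Fin n)) (u : Edge n → ℝ)
    (e : Edge n) : ℝ :=
  if (e : Sym2 (Fin n)) ∈ G.edgeSet then δ / 2 * u e else δ + (1 - δ) * u e

/-- `p` is a program that turns the input `G` into the input `(K_n, λ)` with planted labels, drawing
one fresh random number for each edge of `K_n`, in at most `T n` steps. -/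
def Plants (p : Program) (δ : ℝ) (T : ℕ → ℕ) : Prop :=
  ∀ (n : ℕ) (G : SimpleGraph (Fin n)) (ω : ℕ → ℝ), ∃ t ≤ T n,
    Exec p (graphInput G ω)
      (temporalInput (plantedLabel δ G fun e => ω (edgeIndex e)) fun k => ω (k + n.choose 2)) t

end TemporalClique

/-! ### Loops that run a prescribed number of rounds -/

namespace RealRAM

/-! Averaged over `G`, the planted labels are independent with density `2` on `[0, δ/2]` and `1` on
`[δ, 1]` (`map_plantedLabel`). This density is at most twice the uniform one, so any event gains at
most a factor `2 ^ C(n,2)` in probability when uniform labels are replaced by planted ones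
(`pi_plantedLaw_prod_tapeMeasure_le`). A failure probability `exp(-ω(n²))` absorbs this factor,
hence the algorithm still succeeds with high probability on planted instances.

It remains to see what an almost maximum `δ/2`-temporal clique of a planted instance looks like.
Almost surely no label equals `δ/2`, so labels of edges and of non-edges of `G` differ by more than
`δ/2`, and a temporal clique contains only edges or only non-edges
(`IsTemporalClique.isClique_or_window`). In the first case it is a clique of `G`, and conversely
every clique of `G` is temporal. In the second case its labels lie in one of boundedly many windows
of measure at most `3δ/4`; a first moment bound limits its size to about `k₀ (3δ/4)`, smaller than
`k₀ δ` by a constant factor. The second moment method (`second_moment`) supplies cliques of size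
close to `k₀ δ`, so the returned set is a clique of `G`, and the first moment (`first_moment`)
bounds its size from above.

All this is done for a fixed tolerance `η`; `exists_tendsto_zero_of_forall` then lets `η` tend to
zero with `n`. On the machine side, the planting program ends exactly in the input configuration of
the algorithm, so that running times add up (`plants_plantProgram`). -/

/-- Hoare-style rule for a loop that runs exactly `m` times. -/
theorem Exec.exists_loop {c : Test} {p : Program} (I : ℕ → State → Prop) (m t : ℕ)
    (hstep : ∀ i < m, ∀ s, I i s → c.Holds s ∧ ∃ s', ∃ t' ≤ t, Exec p s s' t' ∧ I (i + 1) s')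
    (hend : ∀ s, I m s → ¬ c.Holds s) (s : State) (hs : I 0 s) :
    ∃ s', ∃ t' ≤ (t + 1) * m + 1, Exec (.loop c p) s s' t' ∧ I m s' := by
  suffices H : ∀ d i s, i + d = m → I i s →
      ∃ s', ∃ t' ≤ (t + 1) * d + 1, Exec (.loop c p) s s' t' ∧ I m s' from
    H m 0 s (by simp) hs
  intro d
  induction d with
  | zero =>
    intro i s hi h
    obtain rfl : i = m := by simpa using hi
    exact ⟨s, 1, by simp, .loop_false (hend s h), h⟩
  | succ d ih =>
    intro i s hi h
    obtain ⟨hc, s₁, t₁, ht₁, he₁, hI₁⟩ := hstep i (by omega) s h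
    obtain ⟨s₂, t₂, ht₂, he₂, hI₂⟩ := ih (i + 1) s₁ (by omega) hI₁
    refine ⟨s₂, t₁ + t₂ + 1, ?_, .loop_true hc he₁ he₂, hI₂⟩
    rw [Nat.mul_succ]; omega

end RealRAM

namespace TemporalClique

open RealRAM

/-! ### The planting program -/

/-- One round of the loop that adds up `0 + 1 + ⋯ + (n - 1)` in integer register `1`. -/
def countBody : Program :=
  .seq (.op (.iadd 1 1 2)) (.op (.iadd 2 2 3))

/-- One round of the loop that replaces the adjacency bit at the address in integer register `4` by
a label. -/
def plantBody : Program :=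
  .seq (.op (.iload 5 4)) (.seq (.op (.draw 0)) (.seq
    (.ite (.ilt 6 5) (.op (.rmul 0 1 0)) (.seq (.op (.rmul 0 2 0)) (.op (.radd 0 3 0))))
    (.seq (.op (.rstore 4 0)) (.seq (.op (.istore 4 6)) (.op (.iadd 4 4 3))))))

/-- Loading the constants. -/
noncomputable def plantInit (δ : ℝ) : Program :=
  .seq (.op (.iconst 3 1)) (.seq (.op (.rconst 1 (δ / 2)))
    (.seq (.op (.rconst 2 (1 - δ))) (.op (.rconst 3 δ))))

/-- Resetting all registers except the one that holds the number of vertices. -/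
noncomputable def plantCleanup : Program :=
  .seq (.op (.iconst 1 0)) (.seq (.op (.iconst 2 0)) (.seq (.op (.iconst 3 0))
    (.seq (.op (.iconst 4 0)) (.seq (.op (.iconst 5 0)) (.seq (.op (.rconst 0 0))
      (.seq (.op (.rconst 1 0)) (.seq (.op (.rconst 2 0)) (.op (.rconst 3 0)))))))))

/-- The program that plants labels in a graph. -/
noncomputable def plantProgram (δ : ℝ) : Program :=
  .seq (plantInit δ) (.seq (.loop (.ilt 2 0) countBody)
    (.seq (.loop (.ilt 4 1) plantBody) plantCleanup))

/-- The invariant of the counting loop. -/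
def CountInv (δ : ℝ) (n : ℕ) (b : ℕ → ℕ) (ω : ℕ → ℝ) (i : ℕ) (s : State) : Prop :=
  s.ireg 0 = n ∧ s.ireg 1 = i.choose 2 ∧ s.ireg 2 = i ∧ s.ireg 3 = 1 ∧ (∀ r, 3 < r → s.ireg r = 0) ∧
    s.rreg 1 = δ / 2 ∧ s.rreg 2 = 1 - δ ∧ s.rreg 3 = δ ∧ (∀ r, 3 < r → s.rreg r = 0) ∧
    s.imem = b ∧ s.rmem = 0 ∧ s.tape = ω

/-- The label written at an address. -/
noncomputable def writtenLabel (δ : ℝ) (b : ℕ → ℕ) (ω : ℕ → ℝ) (k : ℕ) : ℝ :=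
  if 0 < b k then δ / 2 * ω k else δ + (1 - δ) * ω k

/-- The invariant of the planting loop. -/
def PlantInv (δ : ℝ) (n m : ℕ) (b : ℕ → ℕ) (ω : ℕ → ℝ) (i : ℕ) (s : State) : Prop :=
  s.ireg 0 = n ∧ s.ireg 1 = m ∧ s.ireg 3 = 1 ∧ s.ireg 4 = i ∧ (∀ r, 5 < r → s.ireg r = 0) ∧
    s.rreg 1 = δ / 2 ∧ s.rreg 2 = 1 - δ ∧ s.rreg 3 = δ ∧ (∀ r, 3 < r → s.rreg r = 0) ∧
    s.imem = (fun k => if k < i then 0 else b k) ∧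
    s.rmem = (fun k => if k < i then writtenLabel δ b ω k else 0) ∧
    s.tape = fun k => ω (k + i)

theorem countBody_exec {δ : ℝ} {n : ℕ} {b : ℕ → ℕ} {ω : ℕ → ℝ} {i : ℕ} {s : State}
    (h : CountInv δ n b ω i s) :
    ∃ s', ∃ t' ≤ 2, Exec countBody s s' t' ∧ CountInv δ n b ω (i + 1) s' := by
  obtain ⟨h0, h1, h2, h3, h4, r1, r2, r3, r4, hi, hr, ht⟩ := h
  refine ⟨_, _, ?_, .seq (.op _ _) (.op _ _), ?_⟩
  · norm_num
  · have h5 : (i + 1).choose 2 = i.choose 2 + i := by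
      rw [Nat.choose_succ_succ' i 1]; simp [add_comm]
    refine ⟨?_, ?_, ?_, ?_, fun r hr => ?_, ?_, ?_, ?_, fun r hr => ?_, ?_, ?_, ?_⟩ <;>
      simp [Instr.exec, Function.update, *]
    rw [if_neg (by omega), if_neg (by omega)]

theorem plantBody_exec {δ : ℝ} {n m : ℕ} {b : ℕ → ℕ} {ω : ℕ → ℝ} {i : ℕ} {s : State}
    (h : PlantInv δ n m b ω i s) :
    ∃ s', ∃ t' ≤ 8, Exec plantBody s s' t' ∧ PlantInv δ n m b ω (i + 1) s' := by
  obtain ⟨h0, h1, h3, h4, h5, r1, r2, r3, r4, hi, hr, ht⟩ := h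
  -- Register `6` is never written. Its zero serves both in the test of the adjacency bit and as the
  -- value that erases this bit.
  have h6 : s.ireg 6 = 0 := h5 6 (by norm_num)
  by_cases hb : 0 < b i
  · refine ⟨_, _, ?_, .seq (.op _ _) (.seq (.op _ _) (.seq (.ite_true ?_ (.op _ _))
      (.seq (.op _ _) (.seq (.op _ _) (.op _ _))))), ?_⟩
    · norm_num
    · simpa [Test.Holds, Instr.exec, Function.update, h4, h6, hi] using hb
    · refine ⟨?_, ?_, ?_, ?_, fun r hr => ?_, ?_, ?_, ?_, fun r hr => ?_, ?_, ?_, ?_⟩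
      · simp [Instr.exec, Function.update, *]
      · simp [Instr.exec, Function.update, *]
      · simp [Instr.exec, Function.update, *]
      · simp [Instr.exec, Function.update, *]
      · simp [Instr.exec, Function.update, *]
        rw [if_neg (by omega), if_neg (by omega)]
      · simp [Instr.exec, Function.update, *]
      · simp [Instr.exec, Function.update, *]
      · simp [Instr.exec, Function.update, *]
      · simp [Instr.exec, Function.update, *]
        intro h; omega
      · funext k
        simp [Instr.exec, Function.update, *]
        split_ifs <;> first | rfl | omega
      · funext k
        simp [Instr.exec, Function.update, *]
        split_ifs with h1 h2 h3 <;> first | rfl | omega | skip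
        subst h1
        simp [writtenLabel, hb]
      · funext k
        simp [Instr.exec, *]
        congr 1; omega
  · refine ⟨_, _, ?_, .seq (.op _ _) (.seq (.op _ _) (.seq (.ite_false ?_ (.seq (.op _ _) (.op _ _)))
      (.seq (.op _ _) (.seq (.op _ _) (.op _ _))))), ?_⟩
    · norm_num
    · simpa [Test.Holds, Instr.exec, Function.update, h4, h6, hi] using hb
    · refine ⟨?_, ?_, ?_, ?_, fun r hr => ?_, ?_, ?_, ?_, fun r hr => ?_, ?_, ?_, ?_⟩
      · simp [Instr.exec, Function.update, *]
      · simp [Instr.exec, Function.update, *]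
      · simp [Instr.exec, Function.update, *]
      · simp [Instr.exec, Function.update, *]
      · simp [Instr.exec, Function.update, *]
        rw [if_neg (by omega), if_neg (by omega)]
      · simp [Instr.exec, Function.update, *]
      · simp [Instr.exec, Function.update, *]
      · simp [Instr.exec, Function.update, *]
      · simp [Instr.exec, Function.update, *]
        intro h; omega
      · funext k
        simp [Instr.exec, Function.update, *]
        split_ifs <;> first | rfl | omega
      · funext k
        simp [Instr.exec, Function.update, *]
        split_ifs with h1 h2 h3 <;> first | rfl | omega | skip
        subst h1
        simp [writtenLabel, hb]
      · funext k
        simp [Instr.exec, *]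
        congr 1; omega

/-! ### Edge addresses, and correctness of the planting program -/

theorem edgeIndex_lt {n : ℕ} (e : Edge n) : edgeIndex e < n.choose 2 := by
  obtain ⟨i, j, hij, -, h⟩ := edge_eq e
  rw [h]; exact choose_two_add_lt hij i.2

theorem card_edge (n : ℕ) : Fintype.card (Edge n) = n.choose 2 := by
  have h := SimpleGraph.card_edgeFinset_top_eq_card_choose_two (V := Fin n)
  rw [SimpleGraph.edgeFinset_card, Fintype.card_fin] at h
  rw [← h]

/-- The addresses of the edges of `K_n`. -/
noncomputable def edgeEquiv (n : ℕ) : Edge n ≃ Fin (n.choose 2) :=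
  Equiv.ofBijective (fun e => ⟨edgeIndex e, edgeIndex_lt e⟩) <| by
    rw [Fintype.bijective_iff_injective_and_card]
    exact ⟨fun e e' h => edgeIndex_injective (by simpa using h), by rw [card_edge, Fintype.card_fin]⟩

theorem exists_edgeIndex_eq {n k : ℕ} (hk : k < n.choose 2) : ∃ e : Edge n, edgeIndex e = k :=
  ⟨(edgeEquiv n).symm ⟨k, hk⟩, congrArg Fin.val ((edgeEquiv n).apply_symm_apply ⟨k, hk⟩)⟩

theorem extend_edgeIndex {n : ℕ} {α : Type*} (f : Edge n → α) (g : ℕ → α) (e : Edge n) :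
    Function.extend edgeIndex f g (edgeIndex e) = f e :=
  edgeIndex_injective.extend_apply _ _ _

theorem extend_edgeIndex_of_le {n k : ℕ} {α : Type*} (f : Edge n → α) (g : ℕ → α)
    (hk : n.choose 2 ≤ k) : Function.extend edgeIndex f g k = g k := by
  refine Function.extend_apply' _ _ _ ?_
  rintro ⟨e, rfl⟩
  exact absurd (edgeIndex_lt e) (by omega)

theorem plants_plantProgram (δ : ℝ) : Plants (plantProgram δ) δ fun n => 30 * (n ^ 2 + 1) := by
  classical
  intro n G ω
  set b := (graphInput G ω).imem with hb
  obtain ⟨s₁, hs₁, hI₁⟩ : ∃ s₁, Exec (plantInit δ) (graphInput G ω) s₁ 4 ∧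
      CountInv δ n b ω 0 s₁ := by
    refine ⟨_, .seq (.op _ _) (.seq (.op _ _) (.seq (.op _ _) (.op _ _))), ?_⟩
    refine ⟨?_, ?_, ?_, ?_, fun r hr => ?_, ?_, ?_, ?_, fun r hr => ?_, ?_, ?_, ?_⟩ <;>
      simp [Instr.exec, Function.update, graphInput, b]
    · rw [if_neg (by omega), if_neg (by omega)]
    · rw [if_neg (by omega), if_neg (by omega), if_neg (by omega)]
  -- The instruction set has no integer multiplication, so the bound `C(n,2)` of the second loop is
  -- accumulated by additions.
  obtain ⟨s₂, t₂, ht₂, hs₂, hI₂⟩ := Exec.exists_loop (c := .ilt 2 0) (p := countBody)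
    (CountInv δ n b ω) n 2
    (fun i hi s h => ⟨by simpa [Test.Holds, h.1, h.2.2.1] using hi, countBody_exec h⟩)
    (fun s h => by simp [Test.Holds, h.1, h.2.2.1]) s₁ hI₁
  have hI₂' : PlantInv δ n (n.choose 2) b ω 0 s₂ := by
    obtain ⟨h0, h1, h2, h3, h4, r1, r2, r3, r4, hi, hr, ht⟩ := hI₂
    exact ⟨h0, h1, h3, h4 4 (by norm_num), fun r hr => h4 r (by omega), r1, r2, r3, r4, by simp [hi],
      by simp only [hr]; rfl, by simp [ht]⟩
  obtain ⟨s₃, t₃, ht₃, hs₃, hI₃⟩ := Exec.exists_loop (c := .ilt 4 1) (p := plantBody)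
    (PlantInv δ n (n.choose 2) b ω) (n.choose 2) 8
    (fun i hi s h => ⟨by simpa [Test.Holds, h.2.1, h.2.2.2.1] using hi, plantBody_exec h⟩)
    (fun s h => by simp [Test.Holds, h.2.1, h.2.2.2.1]) s₂ hI₂'
  have hclean : Exec plantCleanup s₃
      (temporalInput (plantedLabel δ G fun e => ω (edgeIndex e)) fun k => ω (k + n.choose 2)) 9 := by
    obtain ⟨h0, h1, h3, h4, h5, r1, r2, r3, r4, hi, hr, ht⟩ := hI₃
    have H : Exec plantCleanup s₃ _ 9 := .seq (.op _ _) (.seq (.op _ _) (.seq (.op _ _) (.seq (.op _ _)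
      (.seq (.op _ _) (.seq (.op _ _) (.seq (.op _ _) (.seq (.op _ _) (.op _ _))))))))
    convert H using 1
    simp only [Instr.exec, temporalInput, State.mk.injEq]
    refine ⟨?_, ?_, ?_, ?_, ht.symm⟩
    · funext r
      simp only [Function.update, eq_rec_constant, dite_eq_ite, Pi.zero_apply]
      split_ifs <;> simp_all
      exact (h5 r (by omega)).symm
    · funext r
      simp only [Function.update, eq_rec_constant, dite_eq_ite, Pi.zero_apply]
      split_ifs <;> simp_all
      exact (r4 r (by omega)).symm
    -- Below `C(n,2)` the loop has erased the bits and written the labels; from there on both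
    -- memories hold the default value `0` of `Function.extend`.
    · rw [hi]; funext k
      by_cases hk : k < n.choose 2
      · simp [hk]
      · simp only [hk, if_false, hb, graphInput]
        rw [extend_edgeIndex_of_le _ _ (by omega)]
    · rw [hr]; funext k
      by_cases hk : k < n.choose 2
      · obtain ⟨e, rfl⟩ := exists_edgeIndex_eq hk
        simp only [hk, if_true]
        rw [extend_edgeIndex]
        simp only [writtenLabel, plantedLabel, hb, graphInput]
        rw [extend_edgeIndex]
        split_ifs <;> simp_all
      · simp only [hk, if_false]
        rw [extend_edgeIndex_of_le _ _ (by omega)]; rfl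
  refine ⟨4 + (t₂ + (t₃ + 9)), ?_, .seq hs₁ (.seq hs₂ (.seq hs₃ hclean))⟩
  have h1 : n.choose 2 ≤ n ^ 2 := Nat.choose_le_pow n 2
  have h2 : n ≤ n ^ 2 := Nat.le_self_pow (by norm_num) n
  nlinarith

/-! ### The law of the planted labels -/

theorem map_affine_uniform01 (a : ℝ) {c : ℝ} (hc : 0 < c) :
    uniform01.map (fun x => a + c * x) =
      ENNReal.ofReal c⁻¹ • volume.restrict (Set.Icc a (a + c)) := by
  ext S hS
  rw [Measure.map_apply (by fun_prop) hS, uniform01, Measure.restrict_apply (hS.preimage (by fun_prop)),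
    Measure.smul_apply, Measure.restrict_apply hS]
  have h : (fun x => a + c * x) ⁻¹' S ∩ Set.Icc 0 1 =
      (fun x => c * x) ⁻¹' ((fun x => a + x) ⁻¹' (S ∩ Set.Icc a (a + c))) := by
    ext x
    simp only [Set.mem_inter_iff, Set.mem_preimage, Set.mem_Icc]
    refine and_congr_right fun _ => ⟨fun h => ⟨?_, ?_⟩, fun h => ⟨?_, ?_⟩⟩ <;> nlinarith
  rw [h, Real.volume_preimage_mul_left hc.ne', measure_preimage_add, abs_of_pos (by positivity),
    smul_eq_mul]

instance (n : ℕ) : IsProbabilityMeasure (labelMeasure n) := by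
  unfold labelMeasure; infer_instance

instance : IsProbabilityMeasure tapeMeasure := by
  unfold tapeMeasure; infer_instance

/-- The law of a planted label: the density is `2` on `[0, δ / 2]` and `1` on `[δ, 1]`. -/
noncomputable def plantedLaw (δ : ℝ) : Measure ℝ :=
  (2 : ENNReal) • volume.restrict (Set.Icc 0 (δ / 2)) + volume.restrict (Set.Icc δ 1)

/-- The law of a single edge indicator. -/
noncomputable def bernoulliProp (p : unitInterval) : Measure Prop :=
  unitInterval.toNNReal p • Measure.dirac True +
    unitInterval.toNNReal (unitInterval.symm p) • Measure.dirac False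

instance (p : unitInterval) : IsProbabilityMeasure (bernoulliProp p) := by
  unfold bernoulliProp; infer_instance

open Classical in
/-- The label of an edge as a function of its indicator and a random number. -/
noncomputable def labelOf (δ : ℝ) (x : Prop × ℝ) : ℝ :=
  if x.1 then δ / 2 * x.2 else δ + (1 - δ) * x.2

theorem plantedLabel_eq_labelOf {n : ℕ} (δ : ℝ) (G : SimpleGraph (Fin n)) (u : Edge n → ℝ)
    (e : Edge n) : plantedLabel δ G u e = labelOf δ ((e : Sym2 (Fin n)) ∈ G.edgeSet, u e) := by
  unfold plantedLabel labelOf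
  split_ifs <;> rfl

theorem measurable_labelOf (δ : ℝ) : Measurable (labelOf δ) := by
  unfold labelOf
  refine Measurable.ite ?_ (by fun_prop) (by fun_prop)
  exact measurable_fst (MeasurableSet.of_discrete (s := {P : Prop | P}))

/-- An edge has probability `δ` and label density `2/δ`; a non-edge has probability `1 - δ` and
label density `1/(1 - δ)`. The products are `2` and `1`. -/
theorem map_labelOf {δ : ℝ} (hδ₀ : 0 < δ) (hδ₁ : δ < 1) :
    ((bernoulliProp ⟨δ, hδ₀.le, hδ₁.le⟩).prod uniform01).map (labelOf δ) = plantedLaw δ := by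
  have hm := measurable_labelOf δ
  have h1 : (uniform01.map fun x => labelOf δ (True, x)) =
      ENNReal.ofReal (δ / 2)⁻¹ • volume.restrict (Set.Icc 0 (δ / 2)) := by
    have := map_affine_uniform01 0 (half_pos hδ₀)
    simpa [labelOf] using this
  have h2 : (uniform01.map fun x => labelOf δ (False, x)) =
      ENNReal.ofReal (1 - δ)⁻¹ • volume.restrict (Set.Icc δ 1) := by
    have := map_affine_uniform01 δ (sub_pos.2 hδ₁)
    simpa [labelOf] using this
  have e1 : ((unitInterval.toNNReal ⟨δ, hδ₀.le, hδ₁.le⟩ : NNReal) : ENNReal) = ENNReal.ofReal δ := by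
    rw [ENNReal.ofReal, Real.toNNReal_of_nonneg hδ₀.le]; rfl
  have e2 : ((unitInterval.toNNReal (unitInterval.symm ⟨δ, hδ₀.le, hδ₁.le⟩) : NNReal) : ENNReal) =
      ENNReal.ofReal (1 - δ) := by
    rw [ENNReal.ofReal, Real.toNNReal_of_nonneg (sub_pos.2 hδ₁).le]; rfl
  rw [bernoulliProp, ← Measure.coe_nnreal_smul, ← Measure.coe_nnreal_smul, e1, e2,
    Measure.add_prod, Measure.prod_smul_left, Measure.prod_smul_left, Measure.dirac_prod,
    Measure.dirac_prod, Measure.map_add _ _ hm, Measure.map_smul, Measure.map_smul,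
    Measure.map_map hm (by fun_prop), Measure.map_map hm (by fun_prop)]
  change _ • (uniform01.map fun x => labelOf δ (True, x)) +
    _ • (uniform01.map fun x => labelOf δ (False, x)) = _
  rw [h1, h2, smul_smul, smul_smul, ← ENNReal.ofReal_mul hδ₀.le,
    ← ENNReal.ofReal_mul (sub_pos.2 hδ₁).le, mul_inv_cancel₀ (sub_pos.2 hδ₁).ne', plantedLaw]
  have : δ * (δ / 2)⁻¹ = 2 := by field_simp
  rw [this]; simp

theorem isProbabilityMeasure_plantedLaw {δ : ℝ} (hδ₀ : 0 < δ) (hδ₁ : δ < 1) :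
    IsProbabilityMeasure (plantedLaw δ) := by
  rw [← map_labelOf hδ₀ hδ₁]
  exact Measure.isProbabilityMeasure_map (measurable_labelOf δ).aemeasurable

/-- The two intervals are disjoint subsets of `[0, 1]`, and the density is at most `2` on each of
them. Arbitrary sets are allowed because the failure event of a program is not shown to be
measurable. -/
theorem plantedLaw_le {δ : ℝ} (hδ₀ : 0 < δ) (hδ₁ : δ < 1) (S : Set ℝ) :
    plantedLaw δ S ≤ 2 * uniform01 S := by
  suffices plantedLaw δ ≤ (2 : ENNReal) • uniform01 from this S
  refine Measure.le_iff.2 fun S hS => ?_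
  simp only [plantedLaw, uniform01, Measure.add_apply, Measure.smul_apply, smul_eq_mul,
    Measure.restrict_apply hS]
  have h : volume (S ∩ Set.Icc 0 (δ / 2)) + volume (S ∩ Set.Icc δ 1) ≤ volume (S ∩ Set.Icc 0 1) := by
    rw [← measure_union _ (hS.inter measurableSet_Icc)]
    · refine measure_mono ?_
      rw [← Set.inter_union_distrib_left]
      refine Set.inter_subset_inter_right _ (Set.union_subset ?_ ?_) <;>
        refine Set.Icc_subset_Icc ?_ ?_ <;> linarith
    · rw [Set.disjoint_left]
      rintro x ⟨_, hx⟩ ⟨_, hy⟩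
      linarith [hx.2, hy.1]
  calc _ ≤ 2 * volume (S ∩ Set.Icc 0 (δ / 2)) + 2 * volume (S ∩ Set.Icc δ 1) := by
        gcongr; exact le_mul_of_one_le_left' one_le_two
    _ ≤ _ := by rw [← mul_add]; gcongr

/-! ### Product measures: domination and the law of all planted labels -/

/-- Comparison of the marginals gives comparison of the product measures. -/
theorem pi_le_pow_mul_pi {ι α : Type*} [Fintype ι] [MeasurableSpace α] {μ ν : Measure α}
    [IsProbabilityMeasure μ] [IsProbabilityMeasure ν] {c : NNReal}
    (h : ∀ S, ν S ≤ c * μ S) :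
    Measure.pi (fun _ : ι => ν) ≤ (c : ENNReal) ^ Fintype.card ι • Measure.pi fun _ : ι => μ := by
  have h1 : Measure.pi (fun _ : ι => c • μ) =
      (c : ENNReal) ^ Fintype.card ι • Measure.pi fun _ : ι => μ := by
    refine Measure.pi_eq fun s hs => ?_
    rw [Measure.smul_apply, Measure.pi_pi]
    simp only [Measure.smul_apply, ENNReal.smul_def, smul_eq_mul, Finset.prod_mul_distrib,
      Finset.prod_const, Finset.card_univ]
  rw [← h1]
  refine Measure.le_iff.2 fun S hS => ?_
  rw [Measure.pi_def (fun _ : ι => c • μ), toMeasure_apply _ _ hS]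
  -- `OuterMeasure.pi` is the largest outer measure below the product on boxes, so only boxes need
  -- to be compared.
  have h2 : (Measure.pi fun _ : ι => ν).toOuterMeasure ≤
      OuterMeasure.pi fun _ : ι => (c • μ).toOuterMeasure := by
    rw [OuterMeasure.le_pi]
    intro s _
    change Measure.pi (fun _ : ι => ν) _ ≤ ∏ i, (c • μ) (s i)
    rw [Measure.pi_pi]
    refine Finset.prod_le_prod' fun i _ => ?_
    exact h (s i)
  exact h2 S

/-- The random graph is built from independent indicators of all unordered pairs, with diagonal
pairs never present. Restricting this product measure to the edges of `K_n` leaves independent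
Bernoulli indicators. -/
theorem map_edgeIndicators (n : ℕ) (p : unitInterval) :
    (SimpleGraph.binomialRandom (Fin n) p).map (fun G (e : Edge n) => (e : Sym2 (Fin n)) ∈ G.edgeSet) =
      Measure.pi fun _ : Edge n => bernoulliProp p := by
  have hm : Measurable fun (G : SimpleGraph (Fin n)) (e : Edge n) => (e : Sym2 (Fin n)) ∈ G.edgeSet := by
    refine measurable_pi_lambda _ fun e => ?_
    exact (measurable_set_iff.1 SimpleGraph.measurable_edgeSet) _
  have hm' : Measurable fun (P : Sym2 (Fin n) → Prop) => {i | P i} :=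
    MeasurableEquiv.setOfPred.measurable
  rw [SimpleGraph.binomialRandom_eq_map, Measure.map_map hm (by fun_prop),
    ProbabilityTheory.setBernoulli_eq_map, Measure.map_map (hm.comp (by fun_prop)) hm']
  have h := Measure.infinitePi_map_restrict' (fun i : Sym2 (Fin n) =>
    unitInterval.toNNReal p • Measure.dirac (i ∈ Sym2.diagSetᶜ) +
      unitInterval.toNNReal (unitInterval.symm p) • Measure.dirac False)
      (I := (⊤ : SimpleGraph (Fin n)).edgeSet)
  rw [← Measure.infinitePi_eq_pi]
  convert h using 1
  · congr 1
    funext P e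
    have := e.2
    simp_all [Set.domRestrict]
  · congr 1
    funext e
    have : ((e : Sym2 (Fin n)) ∈ (Sym2.diagSetᶜ : Set (Sym2 (Fin n)))) = True := by
      have := e.2; simp_all
    rw [this]; rfl

/-- Regrouped edge by edge, indicators and random numbers form independent pairs, and each label is
a function of its own pair. -/
theorem map_plantedLabel (n : ℕ) {δ : ℝ} (hδ₀ : 0 < δ) (hδ₁ : δ < 1) :
    ((SimpleGraph.binomialRandom (Fin n) ⟨δ, hδ₀.le, hδ₁.le⟩).prod (labelMeasure n)).map
      (fun x => plantedLabel δ x.1 x.2) = Measure.pi fun _ : Edge n => plantedLaw δ := by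
  set p : unitInterval := ⟨δ, hδ₀.le, hδ₁.le⟩
  have := isProbabilityMeasure_plantedLaw hδ₀ hδ₁
  have hm : Measurable fun (G : SimpleGraph (Fin n)) (e : Edge n) => (e : Sym2 (Fin n)) ∈ G.edgeSet := by
    refine measurable_pi_lambda _ fun e => ?_
    exact (measurable_set_iff.1 SimpleGraph.measurable_edgeSet) _
  have hf : Measurable fun (y : Edge n → Prop × ℝ) e => labelOf δ (y e) :=
    measurable_pi_lambda _ fun e => (measurable_labelOf δ).comp (measurable_pi_apply e)
  have h1 := (measurePreserving_arrowProdEquivProdArrow Prop ℝ (Edge n) (fun _ => bernoulliProp p)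
    (fun _ => uniform01)).symm.map_eq
  have h2 := Measure.map_prod_map (SimpleGraph.binomialRandom (Fin n) p) (labelMeasure n) hm
    (measurable_id)
  rw [map_edgeIndicators, Measure.map_id, labelMeasure] at h2
  rw [h2, Measure.map_map (MeasurableEquiv.measurable _) (by fun_prop)] at h1
  have h3 : IsProbabilityMeasure (((bernoulliProp p).prod uniform01).map (labelOf δ)) := by
    rw [map_labelOf hδ₀ hδ₁]; exact this
  have h4 := Measure.pi_map_pi (μ := fun _ : Edge n => (bernoulliProp p).prod uniform01)
    (f := fun _ => labelOf δ) (fun _ => (measurable_labelOf δ).aemeasurable)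
  rw [map_labelOf hδ₀ hδ₁, ← h1, Measure.map_map hf] at h4
  · rw [← h4]
    congr 1
    funext x e
    exact plantedLabel_eq_labelOf ..
  · exact (MeasurableEquiv.measurable _).comp (by fun_prop)

/-! ### Splitting the tape between planting and the algorithm -/

/-- The first `C(n, 2)` numbers of the tape, as labels, and the rest of the tape. -/
def splitTape (n : ℕ) (ω : ℕ → ℝ) : (Edge n → ℝ) × (ℕ → ℝ) :=
  (fun e => ω (edgeIndex e), fun k => ω (k + n.choose 2))

theorem measurable_splitTape (n : ℕ) : Measurable (splitTape n) := by
  unfold splitTape; fun_prop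

/-- The addresses of the edges followed by the rest of the tape. -/
noncomputable def tapeEquiv (n : ℕ) : Edge n ⊕ ℕ ≃ ℕ :=
  ((edgeEquiv n).sumCongr (Equiv.refl ℕ)).trans
    (Equiv.ofBijective (Sum.elim (fun i : Fin (n.choose 2) => (i : ℕ)) fun k => k + n.choose 2) (by
      constructor
      · rintro (i | k) (j | l) h <;> simp at h ⊢ <;> omega
      · intro k
        by_cases hk : k < n.choose 2
        · exact ⟨.inl ⟨k, hk⟩, rfl⟩
        · exact ⟨.inr (k - n.choose 2), by simp; omega⟩))

theorem map_splitTape (n : ℕ) :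
    tapeMeasure.map (splitTape n) = (labelMeasure n).prod tapeMeasure := by
  have hg : Measurable fun (x : (Edge n → ℝ) × (ℕ → ℝ)) (k : ℕ) =>
      Sum.elim x.1 x.2 ((tapeEquiv n).symm k) := by
    refine measurable_pi_lambda _ fun k => ?_
    cases (tapeEquiv n).symm k <;> simp <;> fun_prop
  -- It is easier to glue the two parts together: a finite-dimensional box of the tape pulls back to
  -- a product of two boxes, and such boxes determine the infinite product measure.
  have h : ((labelMeasure n).prod tapeMeasure).map (fun x k =>
      Sum.elim x.1 x.2 ((tapeEquiv n).symm k)) = tapeMeasure := by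
    refine Measure.eq_infinitePi _ fun s t ht => ?_
    rw [Measure.map_apply hg (.pi s.countable_toSet fun k _ => ht k)]
    have h1 : (fun (x : (Edge n → ℝ) × (ℕ → ℝ)) (k : ℕ) =>
        Sum.elim x.1 x.2 ((tapeEquiv n).symm k)) ⁻¹' (Set.pi s t) =
        (Set.pi ((s.map (tapeEquiv n).symm.toEmbedding).toLeft) fun e => t (tapeEquiv n (.inl e))) ×ˢ
        (Set.pi ((s.map (tapeEquiv n).symm.toEmbedding).toRight)
          fun k => t (tapeEquiv n (.inr k))) := by
      ext x
      simp only [Set.mem_preimage, Set.mem_pi, Set.mem_prod]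
      constructor
      · intro h
        constructor
        · intro e he
          simpa using h (tapeEquiv n (.inl e)) (by simpa [Equiv.symm_apply_eq] using he)
        · intro e he
          simpa using h (tapeEquiv n (.inr e)) (by simpa [Equiv.symm_apply_eq] using he)
      · rintro ⟨h1, h2⟩ k hk
        obtain ⟨e | l, rfl⟩ := (tapeEquiv n).surjective k
        · simpa using h1 e (by simpa [Equiv.symm_apply_eq] using hk)
        · simpa using h2 l (by simpa [Equiv.symm_apply_eq] using hk)
    rw [h1, Measure.prod_prod, labelMeasure, tapeMeasure, ← Measure.infinitePi_eq_pi,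
      Measure.infinitePi_pi _ (fun _ _ => ht _), Measure.infinitePi_pi _ (fun _ _ => ht _)]
    have h2 : ∏ k ∈ s, uniform01 (t k) = ∏ x ∈ s.map (tapeEquiv n).symm.toEmbedding,
        uniform01 (t (tapeEquiv n x)) := by simp
    rw [h2]
    conv_rhs => rw [← Finset.toLeft_disjSum_toRight (u := s.map (tapeEquiv n).symm.toEmbedding)]
    rw [Finset.prod_disjSum]
  conv_lhs => rw [← h]
  rw [Measure.map_map (measurable_splitTape n) hg]
  convert Measure.map_id
  funext x
  ext k
  · have : (tapeEquiv n).symm (edgeIndex k) = .inl k := by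
      rw [Equiv.symm_apply_eq]; rfl
    simp [splitTape, this]
  · have : (tapeEquiv n).symm (k + n.choose 2) = .inr k := by
      rw [Equiv.symm_apply_eq]; rfl
    simp [splitTape, this]

/-- The planted instance, and the random numbers left to the algorithm. -/
noncomputable def plantedInstance (n : ℕ) (δ : ℝ) (x : SimpleGraph (Fin n) × (ℕ → ℝ)) :
    (Edge n → ℝ) × (ℕ → ℝ) :=
  (plantedLabel δ x.1 (splitTape n x.2).1, (splitTape n x.2).2)

theorem measurable_plantedLabel (n : ℕ) (δ : ℝ) :
    Measurable fun x : SimpleGraph (Fin n) × (Edge n → ℝ) => plantedLabel δ x.1 x.2 := by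
  refine measurable_pi_lambda _ fun e => ?_
  have h : Measurable fun x : SimpleGraph (Fin n) × (Edge n → ℝ) =>
      ((e : Sym2 (Fin n)) ∈ x.1.edgeSet, x.2 e) :=
    (((measurable_set_iff.1 SimpleGraph.measurable_edgeSet) _).comp measurable_fst).prodMk
      (by fun_prop)
  simp only [plantedLabel_eq_labelOf]
  exact (measurable_labelOf δ).comp h

theorem measurable_plantedInstance (n : ℕ) (δ : ℝ) : Measurable (plantedInstance n δ) := by
  have h : Measurable fun x : SimpleGraph (Fin n) × (ℕ → ℝ) => splitTape n x.2 :=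
    (measurable_splitTape n).comp measurable_snd
  exact ((measurable_plantedLabel n δ).comp (measurable_fst.prodMk h.fst)).prodMk h.snd

theorem map_plantedInstance (n : ℕ) {δ : ℝ} (hδ₀ : 0 < δ) (hδ₁ : δ < 1) :
    ((SimpleGraph.binomialRandom (Fin n) ⟨δ, hδ₀.le, hδ₁.le⟩).prod tapeMeasure).map
      (plantedInstance n δ) = (Measure.pi fun _ : Edge n => plantedLaw δ).prod tapeMeasure := by
  set μ := SimpleGraph.binomialRandom (Fin n) ⟨δ, hδ₀.le, hδ₁.le⟩ with hμ
  have h1 := Measure.map_prod_map μ tapeMeasure measurable_id (measurable_splitTape n)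
  rw [Measure.map_id, map_splitTape] at h1
  have h2 := Measure.map_prod_map (μ.prod (labelMeasure n)) tapeMeasure
    (measurable_plantedLabel n δ) measurable_id
  rw [Measure.map_id, map_plantedLabel n hδ₀ hδ₁] at h2
  rw [h2, ← (measurePreserving_prodAssoc μ (labelMeasure n) tapeMeasure).symm.map_eq, h1,
    Measure.map_map (MeasurableEquiv.measurable _) (measurable_id.prodMap (measurable_splitTape n)),
    Measure.map_map ((measurable_plantedLabel n δ).prodMap measurable_id)]
  · rfl
  · exact (MeasurableEquiv.measurable _).comp (measurable_id.prodMap (measurable_splitTape n))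

/-! ### First and second moments -/

/-- The edges of `K_n` inside `Q`. -/
noncomputable def insideEdges {n : ℕ} (Q : Finset (Fin n)) : Finset (Edge n) :=
  by classical exact Finset.univ.filter fun e => ∀ v ∈ (e : Sym2 (Fin n)), v ∈ Q

theorem mem_insideEdges {n : ℕ} {Q : Finset (Fin n)} {e : Edge n} :
    e ∈ insideEdges Q ↔ ∀ v ∈ (e : Sym2 (Fin n)), v ∈ Q := by
  simp [insideEdges]

theorem insideEdges_mono {n : ℕ} {Q Q' : Finset (Fin n)} (h : Q ⊆ Q') :
    insideEdges Q ⊆ insideEdges Q' := fun _ he =>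
  mem_insideEdges.2 fun v hv => h (mem_insideEdges.1 he v hv)

theorem insideEdges_inter {n : ℕ} [DecidableEq (Edge n)] (Q Q' : Finset (Fin n)) :
    insideEdges Q ∩ insideEdges Q' = insideEdges (Q ∩ Q') := by
  ext e
  simp only [Finset.mem_inter, mem_insideEdges]
  exact ⟨fun h v hv => ⟨h.1 v hv, h.2 v hv⟩, fun h => ⟨fun v hv => (h v hv).1, fun v hv => (h v hv).2⟩⟩

theorem card_insideEdges {n : ℕ} (Q : Finset (Fin n)) :
    (insideEdges Q).card = Q.card.choose 2 := by
  classical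
  rw [← Sym2.card_image_offDiag Q, ← Finset.card_map (Function.Embedding.subtype _)]
  congr 1
  ext e
  induction e with
  | _ a b =>
    simp only [Finset.mem_map, mem_insideEdges, Function.Embedding.subtype_apply, Finset.mem_image,
      Finset.mem_offDiag, Prod.exists]
    constructor
    · rintro ⟨⟨e, he⟩, h, rfl⟩
      exact ⟨a, b, ⟨h a (by simp), h b (by simp), by simpa using he⟩, rfl⟩
    · rintro ⟨c, d, ⟨hc, hd, hcd⟩, h⟩
      refine ⟨⟨s(c, d), by simpa using hcd⟩, ?_, h⟩
      simp [hc, hd]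

/-- The labellings with all labels of edges in `E` in the set `S`. -/
def allIn {n : ℕ} (E : Finset (Edge n)) (S : Set ℝ) : Set (Edge n → ℝ) :=
  {lab | ∀ e ∈ E, lab e ∈ S}

theorem allIn_inter {n : ℕ} [DecidableEq (Edge n)] (E E' : Finset (Edge n)) (S : Set ℝ) :
    allIn E S ∩ allIn E' S = allIn (E ∪ E') S := by
  ext lab
  simp only [allIn, Set.mem_inter_iff, Set.mem_ofPred_eq, Finset.mem_union]
  exact ⟨fun h e he => he.elim (h.1 e) (h.2 e), fun h => ⟨fun e he => h e (.inl he), fun e he => h e (.inr he)⟩⟩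

theorem measurableSet_allIn {n : ℕ} (E : Finset (Edge n)) {S : Set ℝ} (hS : MeasurableSet S) :
    MeasurableSet (allIn E S) := by
  have : allIn E S = ⋂ e ∈ E, (fun lab : Edge n → ℝ => lab e) ⁻¹' S := by
    ext lab; simp [allIn]
  rw [this]
  exact Finset.measurableSet_biInter _ fun e _ => measurable_pi_apply e hS

theorem pi_allIn {n : ℕ} (ν : Measure ℝ) [IsProbabilityMeasure ν] (E : Finset (Edge n)) (S : Set ℝ) :
    Measure.pi (fun _ : Edge n => ν) (allIn E S) = ν S ^ E.card := by
  classical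
  have : allIn E S = Set.univ.pi fun e => if e ∈ E then S else Set.univ := by
    ext lab
    simp only [allIn, Set.mem_ofPred_eq, Set.mem_univ_pi]
    refine forall_congr' fun e => ?_
    split_ifs with h <;> simp [h]
  rw [this, Measure.pi_pi]
  have h : ∀ e : Edge n, ν (if e ∈ E then S else Set.univ) = if e ∈ E then ν S else 1 := by
    intro e; split_ifs <;> simp
  simp [h, Finset.prod_ite_mem]

theorem first_moment {n : ℕ} (ν : Measure ℝ) [IsProbabilityMeasure ν] (k : ℕ) (S : Set ℝ) :
    Measure.pi (fun _ : Edge n => ν)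
        {lab | ∃ Q : Finset (Fin n), Q.card = k ∧ lab ∈ allIn (insideEdges Q) S} ≤
      (n : ENNReal) ^ k * ν S ^ k.choose 2 := by
  have h : {lab | ∃ Q : Finset (Fin n), Q.card = k ∧ lab ∈ allIn (insideEdges Q) S} =
      ⋃ Q ∈ Finset.powersetCard k Finset.univ, allIn (insideEdges Q) S := by
    ext lab; simp
  rw [h]
  refine (measure_biUnion_finset_le _ _).trans ?_
  rw [Finset.sum_congr rfl fun Q hQ => by
    rw [pi_allIn, card_insideEdges, (Finset.mem_powersetCard.1 hQ).2]]
  rw [Finset.sum_const, Finset.card_powersetCard, nsmul_eq_mul, Finset.card_univ, Fintype.card_fin]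
  gcongr
  exact_mod_cast Nat.choose_le_pow n k

/-- Chebyshev's inequality for the number of events that occur. -/
theorem measureReal_forall_notMem_mul_sq_le {Ω ι : Type*} [MeasurableSpace Ω] (P : Measure Ω)
    [IsProbabilityMeasure P] (I : Finset ι) (A : ι → Set Ω) (hA : ∀ i, MeasurableSet (A i)) :
    P.real {ω | ∀ i ∈ I, ω ∉ A i} * (∑ i ∈ I, P.real (A i)) ^ 2 ≤
      ∑ i ∈ I, ∑ j ∈ I, P.real (A i ∩ A j) - (∑ i ∈ I, P.real (A i)) ^ 2 := by
  set m := ∑ i ∈ I, P.real (A i) with hm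
  set N : Set Ω := {ω | ∀ i ∈ I, ω ∉ A i} with hN
  have hNm : MeasurableSet N := by
    have : N = ⋂ i ∈ I, (A i)ᶜ := by ext; simp [hN]
    rw [this]
    exact Finset.measurableSet_biInter _ fun i _ => (hA i).compl
  let X : Ω → ℝ := fun ω => ∑ i ∈ I, (A i).indicator 1 ω
  have hint : ∀ B : Set Ω, MeasurableSet B → Integrable (B.indicator (1 : Ω → ℝ)) P := fun B hB =>
    (integrable_const (1 : ℝ)).indicator hB
  have hX : Integrable X P := integrable_finsetSum _ fun i _ => hint _ (hA i)
  have hsq : ∀ ω, X ω ^ 2 = ∑ i ∈ I, ∑ j ∈ I, (A i ∩ A j).indicator (1 : Ω → ℝ) ω := by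
    intro ω
    simp only [X, sq, Finset.sum_mul_sum, Set.inter_indicator_one, Pi.mul_apply]
  have hX2 : Integrable (fun ω => X ω ^ 2) P := by
    simp only [hsq]
    exact integrable_finsetSum _ fun i _ => integrable_finsetSum _ fun j _ =>
      hint _ ((hA i).inter (hA j))
  have e1 : ∫ ω, X ω ∂P = m := by
    rw [integral_finsetSum _ fun i _ => hint _ (hA i)]
    simp [hm, integral_indicator_one (hA _)]
  have e2 : ∫ ω, X ω ^ 2 ∂P = ∑ i ∈ I, ∑ j ∈ I, P.real (A i ∩ A j) := by
    simp only [hsq]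
    rw [integral_finsetSum _ fun i _ => integrable_finsetSum _ fun j _ =>
      hint _ ((hA i).inter (hA j))]
    refine Finset.sum_congr rfl fun i _ => ?_
    rw [integral_finsetSum _ fun j _ => hint _ ((hA i).inter (hA j))]
    exact Finset.sum_congr rfl fun j _ => integral_indicator_one ((hA i).inter (hA j))
  have e3 : ∫ ω, (X ω ^ 2 - 2 * m * X ω + m ^ 2) ∂P =
      ∑ i ∈ I, ∑ j ∈ I, P.real (A i ∩ A j) - m ^ 2 := by
    rw [integral_add (f := fun ω => X ω ^ 2 - 2 * m * X ω) (hX2.sub (hX.const_mul _))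
        (integrable_const _),
      integral_sub hX2 (hX.const_mul _), integral_const_mul, e1, e2, integral_const, probReal_univ,
      one_smul]
    ring
  rw [← e3]
  have e4 : P.real N * m ^ 2 = ∫ ω, N.indicator 1 ω * m ^ 2 ∂P := by
    rw [integral_mul_const, integral_indicator_one hNm]
  rw [e4]
  -- Where no event occurs, `X = 0` and `(X - m)² = m²`; elsewhere a square is nonnegative.
  refine integral_mono ((hint _ hNm).mul_const _)
    ((hX2.sub (hX.const_mul _)).add (integrable_const _)) fun ω => ?_
  by_cases hω : ω ∈ N
  · have : X ω = 0 := Finset.sum_eq_zero fun i hi => by simp [hω i hi]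
    simp [hω, this]
  · simp only [hω, not_false_eq_true, Set.indicator_of_notMem, zero_mul]
    nlinarith [sq_nonneg (X ω - m)]

/-- A random `k`-set contains a given `l`-set with probability `∏ (k - i)/(n - i)` over `i < l`, and
every factor is at most `k/n`. -/
theorem choose_sub_mul_pow_le {n k l : ℕ} (hl : l ≤ k) (hk : k ≤ n) :
    (n - l).choose (k - l) * n ^ l ≤ n.choose k * k ^ l := by
  induction l with
  | zero => simp
  | succ l ih =>
    obtain ⟨a, rfl⟩ : ∃ a, k = l + 1 + a := ⟨k - (l + 1), by omega⟩
    obtain ⟨b, rfl⟩ : ∃ b, n = l + 1 + a + b := ⟨n - (l + 1 + a), by omega⟩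
    have ih := ih (by omega)
    rw [show l + 1 + a + b - l = a + b + 1 by omega, show l + 1 + a - l = a + 1 by omega] at ih
    rw [show l + 1 + a + b - (l + 1) = a + b by omega, show l + 1 + a - (l + 1) = a by omega]
    have h1 : (a + b + 1) * (a + b).choose a = (a + b + 1).choose (a + 1) * (a + 1) :=
      Nat.add_one_mul_choose_eq _ _
    have h2 : (a + b).choose a * (l + 1 + a + b) ≤ (l + 1 + a) * (a + b + 1).choose (a + 1) := by
      refine Nat.le_of_mul_le_mul_left ?_ (show 0 < a + b + 1 by omega)
      calc (a + b + 1) * ((a + b).choose a * (l + 1 + a + b))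
          = (a + b + 1).choose (a + 1) * ((a + 1) * (l + 1 + a + b)) := by rw [← mul_assoc, h1]; ring
        _ ≤ (a + b + 1).choose (a + 1) * ((a + b + 1) * (l + 1 + a)) := by
          refine Nat.mul_le_mul_left _ ?_
          nlinarith [Nat.zero_le (b * l)]
        _ = _ := by ring
    calc (a + b).choose a * (l + 1 + a + b) ^ (l + 1)
        = (a + b).choose a * (l + 1 + a + b) * (l + 1 + a + b) ^ l := by ring
      _ ≤ (l + 1 + a) * (a + b + 1).choose (a + 1) * (l + 1 + a + b) ^ l := by gcongr
      _ = (l + 1 + a) * ((a + b + 1).choose (a + 1) * (l + 1 + a + b) ^ l) := by ring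
      _ ≤ (l + 1 + a) * ((l + 1 + a + b).choose (l + 1 + a) * (l + 1 + a) ^ l) := by gcongr
      _ = _ := by ring

theorem card_filter_superset_le {n k : ℕ} (L : Finset (Fin n)) :
    ((Finset.powersetCard k (Finset.univ : Finset (Fin n))).filter (L ⊆ ·)).card ≤
      (n - L.card).choose (k - L.card) := by
  have h : ((Finset.univ : Finset (Fin n)) \ L).card = n - L.card := by
    rw [Finset.card_sdiff_of_subset (Finset.subset_univ _), Finset.card_univ, Fintype.card_fin]
  rw [← h, ← Finset.card_powersetCard]
  refine Finset.card_le_card_of_injOn (· \ L) (fun T hT => ?_) fun T hT T' hT' hTT' => ?_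
  · simp only [Finset.coe_filter, Finset.mem_powersetCard, Set.mem_ofPred_eq] at hT
    simp only [Finset.mem_coe, Finset.mem_powersetCard]
    exact ⟨Finset.sdiff_subset_sdiff (Finset.subset_univ _) le_rfl, by
      rw [Finset.card_sdiff_of_subset hT.2, hT.1.2]⟩
  · simp only [Finset.coe_filter, Finset.mem_powersetCard, Set.mem_ofPred_eq] at hT hT'
    have : T \ L = T' \ L := hTT'
    rw [← Finset.sdiff_union_of_subset hT.2, this, Finset.sdiff_union_of_subset hT'.2]

/-- The generating function of the size of the intersection with a fixed `k`-set. -/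
theorem sum_pow_card_inter_le {n k : ℕ} (hn : 0 < n) (hk : k ≤ n) (S : Finset (Fin n))
    (hS : S.card = k) {r : ℝ} (hr : 0 ≤ r) :
    ∑ T ∈ Finset.powersetCard k (Finset.univ : Finset (Fin n)), r ^ (S ∩ T).card ≤
      n.choose k * (1 + k / n * r) ^ k := by
  have hn' : (0 : ℝ) < n := by exact_mod_cast hn
  calc ∑ T ∈ Finset.powersetCard k (Finset.univ : Finset (Fin n)), r ^ (S ∩ T).card
      ≤ ∑ T ∈ Finset.powersetCard k (Finset.univ : Finset (Fin n)),
          ∑ L ∈ S.powerset, if L ⊆ T then r ^ L.card else 0 := by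
        -- Only the term `L = S ∩ T` is kept; summing over all subsets `L` is what lets the binomial
        -- theorem finish the estimate.
        refine Finset.sum_le_sum fun T _ => ?_
        have h := Finset.single_le_sum (f := fun L => if L ⊆ T then r ^ L.card else 0)
          (s := S.powerset) (fun L _ => by split_ifs <;> positivity)
          (Finset.mem_powerset.2 (Finset.inter_subset_left (s₂ := T)))
        simpa [Finset.inter_subset_right] using h
    _ = ∑ L ∈ S.powerset, (((Finset.powersetCard k (Finset.univ : Finset (Fin n))).filter
          (L ⊆ ·)).card : ℝ) * r ^ L.card := by
        rw [Finset.sum_comm]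
        refine Finset.sum_congr rfl fun L _ => ?_
        rw [← Finset.sum_filter, Finset.sum_const, nsmul_eq_mul]
    _ ≤ ∑ L ∈ S.powerset, n.choose k * ((k / n * r) ^ L.card * 1 ^ (S.card - L.card)) := by
        refine Finset.sum_le_sum fun L hL => ?_
        have hLk : L.card ≤ k := hS ▸ Finset.card_le_card (Finset.mem_powerset.1 hL)
        have h1 : (((n - L.card).choose (k - L.card) : ℕ) : ℝ) * (n : ℝ) ^ L.card ≤
            n.choose k * (k : ℝ) ^ L.card := by exact_mod_cast choose_sub_mul_pow_le hLk hk
        have h2 : (((Finset.powersetCard k (Finset.univ : Finset (Fin n))).filter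
          (L ⊆ ·)).card : ℝ) ≤ ((n - L.card).choose (k - L.card) : ℕ) := by
            exact_mod_cast card_filter_superset_le L
        rw [one_pow, mul_one, mul_pow, div_pow, ← mul_assoc]
        gcongr
        rw [← mul_div_assoc, le_div_iff₀ (by positivity)]
        exact (mul_le_mul_of_nonneg_right h2 (by positivity)).trans h1
    _ = _ := by
        rw [← Finset.mul_sum, Finset.sum_pow_mul_eq_add_pow, hS, add_comm]

/-- Two `k`-sets meeting in `l` vertices share `C(l,2)` edges, which raises their joint probability
above the product by the factor `x ^ (l (l - 1))`. Averaging a bound for this factor over pairs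
controls the relative variance in Chebyshev's inequality. -/
theorem second_moment {n k : ℕ} (hn : 0 < n) (hk : k ≤ n) (ν : Measure ℝ) [IsProbabilityMeasure ν]
    {S : Set ℝ} (hS : MeasurableSet S) {x : ℝ} (hx : 1 ≤ x) (hνS : ν.real S * x ^ 2 = 1) :
    (Measure.pi fun _ : Edge n => ν).real
        {lab | ∀ Q : Finset (Fin n), Q.card = k → lab ∉ allIn (insideEdges Q) S} ≤
      (1 + k / n * x ^ (k - 1)) ^ k - 1 := by
  classical
  set P := Measure.pi fun _ : Edge n => ν with hP
  set p := ν.real S with hp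
  have hp0 : 0 < p := by
    rcases (measureReal_nonneg (μ := ν) (s := S)).eq_or_lt with h | h
    · rw [hp, ← h] at hνS; simp at hνS
    · exact h
  have hPall : ∀ E : Finset (Edge n), P.real (allIn E S) = p ^ E.card := fun E => by
    rw [measureReal_def, hP, pi_allIn, ENNReal.toReal_pow]; rfl
  set I := Finset.powersetCard k (Finset.univ : Finset (Fin n)) with hI
  have h := measureReal_forall_notMem_mul_sq_le P I (fun Q => allIn (insideEdges Q) S)
    fun Q => measurableSet_allIn _ hS
  have hcard : ∀ Q ∈ I, Q.card = k := fun Q hQ => (Finset.mem_powersetCard.1 hQ).2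
  have hsum : ∑ Q ∈ I, P.real (allIn (insideEdges Q) S) = n.choose k * p ^ k.choose 2 := by
    rw [Finset.sum_congr rfl fun Q hQ => by rw [hPall, card_insideEdges, hcard Q hQ]]
    rw [Finset.sum_const, nsmul_eq_mul, hI, Finset.card_powersetCard, Finset.card_univ,
      Fintype.card_fin]
  have hpair : ∀ Q ∈ I, ∀ T ∈ I, P.real (allIn (insideEdges Q) S ∩ allIn (insideEdges T) S) ≤
      (p ^ k.choose 2) ^ 2 * (x ^ (k - 1)) ^ (Q ∩ T).card := by
    intro Q hQ T hT
    have h1 := Finset.card_union_add_card_inter (insideEdges Q) (insideEdges T)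
    rw [insideEdges_inter, card_insideEdges, card_insideEdges, card_insideEdges, hcard Q hQ,
      hcard T hT] at h1
    have h2 : (Q ∩ T).card ≤ k := hcard Q hQ ▸ Finset.card_le_card Finset.inter_subset_left
    set l := (Q ∩ T).card
    rw [allIn_inter, hPall]
    -- The quadratic exponent is replaced by one linear in `l`, as required by the generating
    -- function `sum_pow_card_inter_le`.
    have h3 : 2 * l.choose 2 ≤ (k - 1) * l := by
      have : l.choose 2 * 2 = l * (l - 1) := by
        rw [Nat.choose_two_right, Nat.div_mul_cancel (Nat.even_mul_pred_self l).two_dvd]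
      have h4 : l - 1 ≤ k - 1 := by omega
      nlinarith
    have h4 : p ^ (insideEdges Q ∪ insideEdges T).card =
        (p ^ k.choose 2) ^ 2 * x ^ (2 * l.choose 2) := by
      have h5 : p ^ (insideEdges Q ∪ insideEdges T).card * p ^ l.choose 2 =
          (p ^ k.choose 2) ^ 2 := by
        rw [← pow_add, h1, sq, pow_add]
      have h6 : p ^ l.choose 2 * x ^ (2 * l.choose 2) = 1 := by
        rw [pow_mul, ← mul_pow, hνS, one_pow]
      rw [← h5, mul_assoc, h6, mul_one]
    rw [h4]
    exact mul_le_mul_of_nonneg_left ((pow_le_pow_right₀ hx h3).trans_eq (pow_mul ..)) (by positivity)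
  have hpairs : ∑ Q ∈ I, ∑ T ∈ I, P.real (allIn (insideEdges Q) S ∩ allIn (insideEdges T) S) ≤
      (n.choose k * p ^ k.choose 2) ^ 2 * (1 + k / n * x ^ (k - 1)) ^ k := by
    calc _ ≤ ∑ Q ∈ I, (p ^ k.choose 2) ^ 2 * (n.choose k * (1 + k / n * x ^ (k - 1)) ^ k) := by
          refine Finset.sum_le_sum fun Q hQ => ?_
          refine (Finset.sum_le_sum fun T hT => hpair Q hQ T hT).trans ?_
          rw [← Finset.mul_sum]
          gcongr
          exact sum_pow_card_inter_le hn hk Q (hcard Q hQ) (by positivity)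
      _ = _ := by
          rw [Finset.sum_const, nsmul_eq_mul, hI, Finset.card_powersetCard, Finset.card_univ,
            Fintype.card_fin]
          ring
  rw [hsum] at h
  have hm : 0 < ((n.choose k : ℝ) * p ^ k.choose 2) ^ 2 := by
    have : 0 < n.choose k := Nat.choose_pos hk
    positivity
  have hset : {lab : Edge n → ℝ | ∀ Q : Finset (Fin n), Q.card = k → lab ∉ allIn (insideEdges Q) S} =
      {lab | ∀ Q ∈ I, lab ∉ allIn (insideEdges Q) S} := by
    ext lab; simp [hI]
  rw [hset]
  refine le_of_mul_le_mul_right (h.trans ?_) hm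
  linarith

open Filter Topology

/-! ### Asymptotics -/

theorem k₀_nonneg {q : ℝ} (hq₀ : 0 < q) (hq₁ : q < 1) (n : ℕ) : 0 ≤ k₀ q n := by
  have : 0 < Real.log (1 / q) := Real.log_pos (by rw [lt_div_iff₀ hq₀]; linarith)
  have := Real.log_natCast_nonneg n
  unfold k₀; positivity

/-- `q ^ (t k₀ / 2) = n ^ (-t)`, written with the square root of `q`. -/
theorem exp_log_sqrt_mul_k₀ {q : ℝ} (hq₀ : 0 < q) (hq₁ : q < 1) {n : ℕ} (hn : 0 < n) (t : ℝ) :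
    Real.exp (Real.log (√q) * (t * k₀ q n)) = (n : ℝ) ^ (-t) := by
  have h1 : Real.log q ≠ 0 := (Real.log_neg hq₀ hq₁).ne
  rw [Real.rpow_def_of_pos (by exact_mod_cast hn), Real.log_sqrt hq₀.le, k₀, one_div, Real.log_inv]
  congr 1
  field_simp

/-- With `x = √q` the quantity equals `(n x ^ (k - 1)) ^ k`. Since `x ^ k ≤ n ^ (-C)`, the base is
at most `x⁻¹ n ^ (1 - C)`, which tends to zero. -/
theorem tendsto_first_moment {q C : ℝ} (hq₀ : 0 < q) (hq₁ : q < 1) (hC : 1 < C) {k : ℕ → ℕ}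
    (hk : ∀ n, C * k₀ q n ≤ k n) :
    Tendsto (fun n : ℕ => (n : ENNReal) ^ k n * ENNReal.ofReal q ^ (k n).choose 2) atTop (𝓝 0) := by
  set x := √q with hx
  have hx0 : 0 < x := Real.sqrt_pos.2 hq₀
  have hxq : x ^ 2 = q := Real.sq_sqrt hq₀.le
  have hlim : Tendsto (fun n : ℕ => x⁻¹ * (n : ℝ) ^ (-(C - 1))) atTop (𝓝 0) := by
    have := ((tendsto_rpow_neg_atTop (sub_pos.2 hC)).comp tendsto_natCast_atTop_atTop).const_mul x⁻¹
    simpa using this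
  have hreal : Tendsto (fun n : ℕ => (n : ℝ) ^ k n * q ^ (k n).choose 2) atTop (𝓝 0) := by
    refine squeeze_zero' (Eventually.of_forall fun n => by positivity) ?_ hlim
    filter_upwards [hlim.eventually_le_const one_pos, eventually_ge_atTop 2] with n h1 hn
    have hn0 : (0 : ℝ) < n := by exact_mod_cast (by omega : 0 < n)
    have hk1 : k n ≠ 0 := by
      intro h0
      have h2 := hk n
      have h3 : 0 < k₀ q n := by
        have : 0 < Real.log (1 / q) := Real.log_pos (by rw [lt_div_iff₀ hq₀]; linarith)
        have : 0 < Real.log n := Real.log_pos (by exact_mod_cast hn)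
        unfold k₀; positivity
      rw [h0] at h2
      have : 0 < C * k₀ q n := by positivity
      simp at h2; linarith
    have e1 : (n : ℝ) ^ k n * q ^ (k n).choose 2 = (n * x ^ (k n - 1)) ^ k n := by
      rw [mul_pow, ← pow_mul, ← hxq, ← pow_mul]
      congr 2
      rw [Nat.choose_two_right, Nat.mul_div_cancel' (Nat.even_mul_pred_self _).two_dvd, mul_comm]
    have e2 : n * x ^ (k n - 1) ≤ x⁻¹ * (n : ℝ) ^ (-(C - 1)) := by
      have h4 : x ^ k n ≤ (n : ℝ) ^ (-C) := by
        rw [← exp_log_sqrt_mul_k₀ hq₀ hq₁ (by omega : 0 < n), ← Real.exp_log (pow_pos hx0 (k n)),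
          Real.log_pow, mul_comm]
        refine Real.exp_le_exp.2 ?_
        refine mul_le_mul_of_nonpos_left (hk n) ?_
        exact Real.log_nonpos hx0.le (Real.sqrt_le_one.2 hq₁.le)
      have h5 : x ^ (k n - 1) = x⁻¹ * x ^ k n := by
        obtain ⟨l, hl⟩ := Nat.exists_eq_succ_of_ne_zero hk1
        rw [hl, Nat.succ_sub_one, pow_succ]; field_simp
      have h6 : (n : ℝ) ^ (-(C - 1)) = n * (n : ℝ) ^ (-C) := by
        rw [show -(C - 1) = 1 + -C by ring, Real.rpow_add hn0, Real.rpow_one]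
      rw [h5, h6]
      calc (n : ℝ) * (x⁻¹ * x ^ k n) ≤ n * (x⁻¹ * (n : ℝ) ^ (-C)) := by gcongr
        _ = _ := by ring
    rw [e1]
    calc (n * x ^ (k n - 1)) ^ k n ≤ n * x ^ (k n - 1) :=
          pow_le_of_le_one (by positivity) (e2.trans h1) hk1
      _ ≤ _ := e2
  have h := ENNReal.tendsto_ofReal hreal
  rw [ENNReal.ofReal_zero] at h
  refine h.congr fun n => ?_
  rw [ENNReal.ofReal_mul (by positivity), ENNReal.ofReal_pow (by positivity),
    ENNReal.ofReal_pow hq₀.le, ENNReal.ofReal_natCast]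

theorem tendsto_k₀_mul_rpow_neg (q : ℝ) {s : ℝ} (hs : 0 < s) :
    Tendsto (fun n : ℕ => (k₀ q n + 1) * (n : ℝ) ^ (-s)) atTop (𝓝 0) := by
  have h1 : Tendsto (fun n : ℕ => Real.log n * (n : ℝ) ^ (-s)) atTop (𝓝 0) := by
    have := ((isLittleO_log_rpow_atTop hs).tendsto_div_nhds_zero).comp tendsto_natCast_atTop_atTop
    refine this.congr fun n => ?_
    simp [Real.rpow_neg, div_eq_mul_inv]
  have h2 := (tendsto_rpow_neg_atTop hs).comp tendsto_natCast_atTop_atTop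
  have h3 := (h1.const_mul (2 / Real.log (1 / q))).add h2
  rw [mul_zero, add_zero] at h3
  refine h3.congr fun n => ?_
  simp only [k₀, Function.comp]
  ring

/-- The clique size at which the second moment method succeeds. -/
noncomputable def lowerSize (p η : ℝ) (n : ℕ) : ℕ := ⌈(1 - η) * k₀ p n⌉₊

theorem lowerSize_le {p η : ℝ} (hp₀ : 0 < p) (hp₁ : p < 1) (hη₀ : 0 < η) (n : ℕ) :
    (lowerSize p η n : ℝ) ≤ k₀ p n + 1 := by
  have h := k₀_nonneg hp₀ hp₁ n
  unfold lowerSize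
  rcases le_total ((1 - η) * k₀ p n) 0 with h1 | h1
  · rw [Nat.ceil_eq_zero.2 h1]; simp; linarith
  · have := Nat.ceil_lt_add_one h1
    nlinarith

/-- At this size `(√p)⁻¹ ^ (k - 1) ≤ n ^ (1 - η)`, so the power is at most `exp (k² n ^ (-η))`; as
`k` is logarithmic in `n`, the exponent vanishes. -/
theorem tendsto_second_moment {p η : ℝ} (hp₀ : 0 < p) (hp₁ : p < 1) (hη₀ : 0 < η) (hη₁ : η < 1) :
    Tendsto (fun n : ℕ => (1 + lowerSize p η n / n * (√p)⁻¹ ^ (lowerSize p η n - 1)) ^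
      lowerSize p η n - 1) atTop (𝓝 0) := by
  have hlim := tendsto_k₀_mul_rpow_neg p (half_pos hη₀)
  have hlim2 : Tendsto (fun n : ℕ =>
      Real.exp (((k₀ p n + 1) * (n : ℝ) ^ (-(η / 2))) ^ 2) - 1) atTop (𝓝 0) := by
    have := ((Real.continuous_exp.tendsto _).comp (hlim.pow 2)).sub_const 1
    simpa using this
  have hx : 1 ≤ (√p)⁻¹ := (one_le_inv₀ (Real.sqrt_pos.2 hp₀)).2 (Real.sqrt_le_one.2 hp₁.le)
  refine squeeze_zero' (Eventually.of_forall fun n => ?_) ?_ hlim2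
  · exact sub_nonneg.2 (one_le_pow₀ (le_add_of_nonneg_right (by positivity)))
  filter_upwards [eventually_ge_atTop 1] with n hn
  have hn0 : (0 : ℝ) < n := by exact_mod_cast hn
  set k := lowerSize p η n with hk
  have hkk := lowerSize_le hp₀ hp₁ hη₀ n
  rw [← hk] at hkk
  have h1 : (√p)⁻¹ ^ (k - 1) ≤ (n : ℝ) ^ (1 - η) := by
    -- The `- 1` compensates for rounding up in `lowerSize`.
    have h2 : (((k - 1 : ℕ) : ℕ) : ℝ) ≤ (1 - η) * k₀ p n := by
      have h3 : 0 ≤ (1 - η) * k₀ p n := mul_nonneg (by linarith) (k₀_nonneg hp₀ hp₁ n)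
      rcases Nat.eq_zero_or_pos k with h0 | h0
      · rw [h0]; simpa using h3
      · have := Nat.ceil_lt_add_one h3
        rw [Nat.cast_sub h0]
        change (k : ℝ) < _ at this
        push_cast; linarith
    have h3 := exp_log_sqrt_mul_k₀ hp₀ hp₁ hn (-(1 - η))
    rw [neg_neg] at h3
    rw [← h3, ← Real.exp_log (pow_pos (lt_of_lt_of_le one_pos hx) (k - 1)), Real.log_pow, Real.log_inv]
    refine Real.exp_le_exp.2 ?_
    have h4 : Real.log (√p) ≤ 0 := Real.log_nonpos (Real.sqrt_nonneg _) (Real.sqrt_le_one.2 hp₁.le)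
    nlinarith
  have h2 : (k : ℝ) / n * (√p)⁻¹ ^ (k - 1) ≤ k * (n : ℝ) ^ (-η) := by
    calc (k : ℝ) / n * (√p)⁻¹ ^ (k - 1) ≤ k / n * (n : ℝ) ^ (1 - η) := by gcongr
      _ = _ := by
        rw [show 1 - η = 1 + -η by ring, Real.rpow_add hn0, Real.rpow_one]; field_simp
  have h3 : (1 + (k : ℝ) / n * (√p)⁻¹ ^ (k - 1)) ^ k ≤
      Real.exp (((k₀ p n + 1) * (n : ℝ) ^ (-(η / 2))) ^ 2) := by
    calc (1 + (k : ℝ) / n * (√p)⁻¹ ^ (k - 1)) ^ k ≤ Real.exp (k * (n : ℝ) ^ (-η)) ^ k := by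
          gcongr
          have := Real.add_one_le_exp (k * (n : ℝ) ^ (-η))
          linarith
      _ = Real.exp ((k * (n : ℝ) ^ (-(η / 2))) ^ 2) := by
          rw [← Real.exp_nat_mul]
          congr 1
          rw [mul_pow, ← Real.rpow_natCast ((n : ℝ) ^ (-(η / 2))), ← Real.rpow_mul hn0.le]
          have : -(η / 2) * ((2 : ℕ) : ℝ) = -η := by push_cast; ring
          rw [this]; ring
      _ ≤ _ := by gcongr
  linarith

theorem eventually_lowerSize_le {p η : ℝ} (hp₀ : 0 < p) (hp₁ : p < 1) (hη₀ : 0 < η) :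
    ∀ᶠ n : ℕ in atTop, lowerSize p η n ≤ n := by
  filter_upwards [(tendsto_k₀_mul_rpow_neg p one_pos).eventually_le_const one_pos,
    eventually_ge_atTop 1] with n h hn
  have hn0 : (0 : ℝ) < n := by exact_mod_cast hn
  rw [Real.rpow_neg_one, ← div_eq_mul_inv, div_le_one hn0] at h
  exact_mod_cast (lowerSize_le hp₀ hp₁ hη₀ n).trans h

/-- If `F η n → 0` for all small `η`, then `F (ε n) n → 0` for some `ε n → 0`. -/
theorem exists_tendsto_zero_of_forall {F : ℝ → ℕ → ENNReal} {η₀ : ℝ} (hη₀ : 0 < η₀)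
    (hF1 : ∀ η n, F η n ≤ 1) (hF : ∀ η, 0 < η → η < η₀ → Tendsto (F η) atTop (𝓝 0)) :
    ∃ ε : ℕ → ℝ, Tendsto ε atTop (𝓝 0) ∧ Tendsto (fun n => F (ε n) n) atTop (𝓝 0) := by
  -- Choosing `ε n` almost minimal in `S n` needs no monotonicity of `F` in `η`. The bound `F ≤ 1`
  -- puts `1` in every `S n`, so none is empty.
  let S : ℕ → Set ℝ := fun n => {η | 0 < η ∧ F η n ≤ ENNReal.ofReal η}
  have hS1 : ∀ n, (1 : ℝ) ∈ S n := fun n => ⟨one_pos, by simpa using hF1 1 n⟩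
  have hbdd : ∀ n, BddBelow (S n) := fun n => ⟨0, fun η hη => hη.1.le⟩
  have hex : ∀ n : ℕ, ∃ η ∈ S n, η < sInf (S n) + 1 / ((n : ℝ) + 1) := fun n =>
    exists_lt_of_csInf_lt ⟨1, hS1 n⟩ (lt_add_of_pos_right _ (by positivity))
  choose ε hεS hε using hex
  have hε0 : Tendsto ε atTop (𝓝 0) := by
    rw [Metric.tendsto_atTop']
    intro r hr
    set η := min (r / 2) (η₀ / 2) with hη
    have hη0 : 0 < η := lt_min (by positivity) (by positivity)
    have hη1 : η < η₀ := (min_le_right _ _).trans_lt (by linarith)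
    have h1 := (hF η hη0 hη1).eventually_le_const (ENNReal.ofReal_pos.2 hη0)
    have h2 := (tendsto_one_div_add_atTop_nhds_zero_nat (𝕜 := ℝ)).eventually_lt_const (half_pos hr)
    obtain ⟨N, hN⟩ := eventually_atTop.1 (h1.and h2)
    refine ⟨N, fun n hn => ?_⟩
    obtain ⟨h3, h4⟩ := hN n hn.le
    have h5 : sInf (S n) ≤ η := csInf_le (hbdd n) ⟨hη0, h3⟩
    have h6 : η ≤ r / 2 := min_le_left _ _
    rw [Real.dist_eq, sub_zero, abs_of_pos (hεS n).1]
    linarith [hε n]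
  refine ⟨ε, hε0, ?_⟩
  have h := ENNReal.tendsto_ofReal hε0
  rw [ENNReal.ofReal_zero] at h
  exact tendsto_of_tendsto_of_tendsto_of_le_of_le tendsto_const_nhds h (fun _ => zero_le)
    fun n => (hεS n).2

/-- Eventually `f n ≥ 2 n²`, while the power of two is at most `exp (n²)`. -/
theorem tendsto_two_pow_mul_exp_neg {f : ℕ → ℝ}
    (hf : Tendsto (fun n : ℕ => f n / (n : ℝ) ^ 2) atTop atTop) :
    Tendsto (fun n : ℕ => (2 : ENNReal) ^ n.choose 2 * ENNReal.ofReal (Real.exp (-f n))) atTop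
      (𝓝 0) := by
  have hlim : Tendsto (fun n : ℕ => Real.exp (-(n : ℝ))) atTop (𝓝 0) :=
    Real.tendsto_exp_neg_atTop_nhds_zero.comp tendsto_natCast_atTop_atTop
  have hreal : Tendsto (fun n : ℕ => (2 : ℝ) ^ n.choose 2 * Real.exp (-f n)) atTop (𝓝 0) := by
    refine squeeze_zero' (Eventually.of_forall fun n => by positivity) ?_ hlim
    filter_upwards [hf.eventually_ge_atTop 2, eventually_ge_atTop 1] with n h hn
    have hn1 : (1 : ℝ) ≤ n := by exact_mod_cast hn
    rw [le_div_iff₀ (by positivity)] at h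
    have h1 : (2 : ℝ) ^ n.choose 2 ≤ Real.exp ((n : ℝ) ^ 2) := by
      calc (2 : ℝ) ^ n.choose 2 ≤ 2 ^ (n ^ 2) :=
            pow_le_pow_right₀ one_le_two (Nat.choose_le_pow n 2)
        _ ≤ Real.exp 1 ^ (n ^ 2) := by
            gcongr
            have := Real.add_one_le_exp 1
            linarith
        _ = _ := by rw [← Real.exp_nat_mul]; push_cast; ring_nf
    calc (2 : ℝ) ^ n.choose 2 * Real.exp (-f n) ≤ Real.exp ((n : ℝ) ^ 2) * Real.exp (-f n) := by gcongr
      _ = Real.exp ((n : ℝ) ^ 2 - f n) := by rw [← Real.exp_add]; ring_nf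
      _ ≤ _ := Real.exp_le_exp.2 (by nlinarith)
  have h := ENNReal.tendsto_ofReal hreal
  rw [ENNReal.ofReal_zero] at h
  refine h.congr fun n => ?_
  rw [ENNReal.ofReal_mul (by positivity), ENNReal.ofReal_pow (by positivity)]
  simp

/-! ### Cliques of the planted instance -/

theorem plantedLabel_of_mem {n : ℕ} {δ : ℝ} (hδ₀ : 0 < δ) {G : SimpleGraph (Fin n)}
    {u : Edge n → ℝ} {e : Edge n} (hu : u e ∈ Set.Icc (0 : ℝ) 1) (he : (e : Sym2 (Fin n)) ∈ G.edgeSet) :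
    plantedLabel δ G u e ∈ Set.Icc 0 (δ / 2) := by
  rw [plantedLabel, if_pos he]
  constructor <;> nlinarith [hu.1, hu.2]

theorem plantedLabel_of_notMem {n : ℕ} {δ : ℝ} (hδ₁ : δ < 1) {G : SimpleGraph (Fin n)}
    {u : Edge n → ℝ} {e : Edge n} (hu : u e ∈ Set.Icc (0 : ℝ) 1) (he : (e : Sym2 (Fin n)) ∉ G.edgeSet) :
    plantedLabel δ G u e ∈ Set.Icc δ 1 := by
  rw [plantedLabel, if_neg he]
  constructor <;> nlinarith [hu.1, hu.2]

theorem plantedLabel_mem_Icc {n : ℕ} {δ : ℝ} (hδ₀ : 0 < δ) (hδ₁ : δ < 1) {G : SimpleGraph (Fin n)}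
    {u : Edge n → ℝ} {e : Edge n} (hu : u e ∈ Set.Icc (0 : ℝ) 1) :
    plantedLabel δ G u e ∈ Set.Icc (0 : ℝ) 1 := by
  by_cases he : (e : Sym2 (Fin n)) ∈ G.edgeSet
  · have := plantedLabel_of_mem hδ₀ hu he
    exact ⟨this.1, this.2.trans (by linarith)⟩
  · have := plantedLabel_of_notMem hδ₁ hu he
    exact ⟨hδ₀.le.trans this.1, this.2⟩

/-- The part in `[δ, 1]` of the interval of length `3 δ / 4` that starts at `j δ / 4`. -/
def window (δ : ℝ) (j : ℕ) : Set ℝ := Set.Icc (j * (δ / 4)) (j * (δ / 4) + 3 * δ / 4) ∩ Set.Icc δ 1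

/-- Some vertex set of size `k` has all its labels in `S`. -/
def hasAllIn (n k : ℕ) (S : Set ℝ) : Set (Edge n → ℝ) :=
  {lab | ∃ Q : Finset (Fin n), Q.card = k ∧ lab ∈ allIn (insideEdges Q) S}

theorem mem_hasAllIn_of_le {n k : ℕ} {S : Set ℝ} {lab : Edge n → ℝ} {Q : Finset (Fin n)}
    (hk : k ≤ Q.card) (h : lab ∈ allIn (insideEdges Q) S) : lab ∈ hasAllIn n k S := by
  obtain ⟨Q', hQ', hc⟩ := Finset.exists_subset_card_eq hk
  exact ⟨Q', hc, fun e he => h e (insideEdges_mono hQ' he)⟩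

/-- A temporal clique of a planted instance is a clique of the graph or has all its labels in a
window of non-edges. -/
theorem IsTemporalClique.isClique_or_window {n : ℕ} {δ : ℝ} (hδ₀ : 0 < δ) (hδ₁ : δ < 1)
    {G : SimpleGraph (Fin n)} {u : Edge n → ℝ} (hu : ∀ e, u e ∈ Set.Icc (0 : ℝ) 1)
    (hne : ∀ e, plantedLabel δ G u e ≠ δ / 2) {Q : Finset (Fin n)}
    (hQ : IsTemporalClique ⊤ (plantedLabel δ G u) (δ / 2) Q) :
    (G.IsClique (Q : Set (Fin n)) ∧
        plantedLabel δ G u ∈ allIn (insideEdges Q) (Set.Icc 0 (δ / 2))) ∨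
      ∃ j ∈ Finset.range (⌊4 / δ⌋₊ + 1), plantedLabel δ G u ∈ allIn (insideEdges Q) (window δ j) := by
  set lab := plantedLabel δ G u with hlab
  by_cases hG : ∀ e ∈ insideEdges Q, (e : Sym2 (Fin n)) ∈ G.edgeSet
  · refine .inl ⟨fun a ha b hb hab => ?_, fun e he => plantedLabel_of_mem hδ₀ (hu e) (hG e he)⟩
    refine hG ⟨s(a, b), by simpa using hab⟩ (mem_insideEdges.2 fun v hv => ?_)
    rcases Sym2.mem_iff.1 hv with rfl | rfl
    · exact ha
    · exact hb
  · right
    push Not at hG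
    obtain ⟨e₀, he₀, hG₀⟩ := hG
    have h₀ := plantedLabel_of_notMem hδ₁ (hu e₀) hG₀
    -- One non-edge excludes all edges: their labels are strictly below `δ/2`, too far from a label
    -- that is at least `δ`.
    have hall : ∀ e ∈ insideEdges Q, lab e ∈ Set.Icc δ 1 := by
      intro e he
      refine plantedLabel_of_notMem hδ₁ (hu e) fun heG => ?_
      have h1 := plantedLabel_of_mem hδ₀ (hu e) heG
      have h2 := lt_of_le_of_ne h1.2 (hne e)
      have h3 := hQ.2 e₀ e (mem_insideEdges.1 he₀) (mem_insideEdges.1 he)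
      have h4 := (abs_le.1 h3).2
      linarith [h₀.1]
    -- The smallest label is rounded down to a multiple of `δ/4`. All labels exceed it by at most
    -- `δ/2`, whence the window length `δ/2 + δ/4`.
    obtain ⟨e₁, he₁, hmin⟩ := Finset.exists_min_image (insideEdges Q) lab ⟨e₀, he₀⟩
    have h₁ := hall e₁ he₁
    have hδ4 : 0 < δ / 4 := by positivity
    have hpos : 0 ≤ lab e₁ / (δ / 4) := div_nonneg (hδ₀.le.trans h₁.1) hδ4.le
    have hj1 := Nat.floor_le hpos
    have hj2 := Nat.lt_floor_add_one (lab e₁ / (δ / 4))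
    rw [le_div_iff₀ hδ4] at hj1
    rw [div_lt_iff₀ hδ4] at hj2
    refine ⟨⌊lab e₁ / (δ / 4)⌋₊, ?_, fun e he => ⟨⟨hj1.trans (hmin e he), ?_⟩, hall e he⟩⟩
    · rw [Finset.mem_range, Nat.lt_succ_iff]
      refine Nat.floor_le_floor ?_
      rw [div_le_div_iff₀ hδ4 hδ₀]
      nlinarith [h₁.2]
    · have h3 := hQ.2 e e₁ (mem_insideEdges.1 he) (mem_insideEdges.1 he₁)
      have h4 := (abs_le.1 h3).2
      linarith

theorem isTemporalClique_of_mem_allIn {n : ℕ} {δ : ℝ} {lab : Edge n → ℝ} {Q : Finset (Fin n)}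
    (h : lab ∈ allIn (insideEdges Q) (Set.Icc 0 δ)) : IsTemporalClique ⊤ lab δ Q := by
  refine ⟨fun a _ b _ hab => by simpa using hab, fun e e' he he' => ?_⟩
  have h1 := h e (mem_insideEdges.2 he)
  have h2 := h e' (mem_insideEdges.2 he')
  rw [abs_le]
  constructor <;> linarith [h1.1, h1.2, h2.1, h2.2]

/-- Outside the exceptional events, an approximate maximum temporal clique of the planted instance
is a clique of the graph of the right size. -/
theorem isClique_and_abs_card_sub_le {n : ℕ} {δ η ε : ℝ} (hδ₀ : 0 < δ) (hδ₁ : δ < 1)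
    {G : SimpleGraph (Fin n)} {u : Edge n → ℝ} (hu : ∀ e, u e ∈ Set.Icc (0 : ℝ) 1)
    (hne : ∀ e, plantedLabel δ G u e ≠ δ / 2)
    (hε₁ : ε ≤ 1) (hεη : 1 - η ≤ (1 - ε) * (1 - η / 2))
    (hupper : plantedLabel δ G u ∉ hasAllIn n ⌈(1 + η) * k₀ δ n⌉₊ (Set.Icc 0 (δ / 2)))
    (hlower : plantedLabel δ G u ∈ hasAllIn n (lowerSize δ (η / 2) n) (Set.Icc 0 (δ / 2)))
    (hwindow : ∀ j ∈ Finset.range (⌊4 / δ⌋₊ + 1),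
      plantedLabel δ G u ∉ hasAllIn n ⌈(1 - η) * k₀ δ n⌉₊ (window δ j))
    {Q : Finset (Fin n)} (hQ : IsApproxMax (plantedLabel δ G u) (δ / 2) ε Q) :
    G.IsClique (Q : Set (Fin n)) ∧ |(Q.card : ℝ) - k₀ δ n| ≤ η * k₀ δ n := by
  have hk := k₀_nonneg hδ₀ hδ₁ n
  -- The planted instance has a temporal clique of relative size `1 - η/2`; the other half of `η`
  -- pays for the approximation factor `1 - ε`.
  have hge : (1 - η) * k₀ δ n ≤ Q.card := by
    obtain ⟨Q', hc, hin⟩ := hlower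
    have h1 := hQ.2 Q' (isTemporalClique_of_mem_allIn hin)
    have h2 : (1 - η / 2) * k₀ δ n ≤ Q'.card := by rw [hc]; exact Nat.le_ceil _
    calc (1 - η) * k₀ δ n ≤ (1 - ε) * (1 - η / 2) * k₀ δ n := by gcongr
      _ = (1 - ε) * ((1 - η / 2) * k₀ δ n) := by ring
      _ ≤ (1 - ε) * Q'.card := by gcongr
      _ ≤ _ := h1
  rcases hQ.1.isClique_or_window hδ₀ hδ₁ hu hne with ⟨hcl, hin⟩ | ⟨j, hj, hin⟩
  · refine ⟨hcl, ?_⟩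
    have hle : (Q.card : ℝ) ≤ (1 + η) * k₀ δ n := by
      by_contra hlt
      exact hupper (mem_hasAllIn_of_le (Nat.ceil_le.2 (not_le.1 hlt).le) hin)
    rw [abs_le]
    constructor <;> linarith
  · exact absurd (mem_hasAllIn_of_le (Nat.ceil_le.2 hge) hin) (hwindow j hj)

/-! ### Probabilities of the exceptional events -/

theorem plantedLaw_Icc {δ : ℝ} (hδ₀ : 0 < δ) : plantedLaw δ (Set.Icc 0 (δ / 2)) = ENNReal.ofReal δ := by
  have h : Set.Icc 0 (δ / 2) ∩ Set.Icc δ 1 = ∅ := by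
    rw [Set.eq_empty_iff_forall_notMem]
    rintro x ⟨hx, hy⟩
    linarith [hx.2, hy.1]
  simp only [plantedLaw, Measure.add_apply, Measure.smul_apply, smul_eq_mul,
    Measure.restrict_apply measurableSet_Icc, Set.inter_self, h, measure_empty, add_zero,
    Real.volume_Icc, sub_zero]
  rw [← ENNReal.ofReal_ofNat 2, ← ENNReal.ofReal_mul (by norm_num)]
  congr 1; ring

theorem plantedLaw_window_le {δ : ℝ} (hδ₀ : 0 < δ) (j : ℕ) :
    plantedLaw δ (window δ j) ≤ ENNReal.ofReal (3 * δ / 4) := by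
  have hm : MeasurableSet (window δ j) := measurableSet_Icc.inter measurableSet_Icc
  have h : window δ j ∩ Set.Icc 0 (δ / 2) = ∅ := by
    rw [Set.eq_empty_iff_forall_notMem]
    rintro x ⟨hx, hy⟩
    linarith [hx.2.1, hy.2]
  simp only [plantedLaw, Measure.add_apply, Measure.smul_apply, smul_eq_mul,
    Measure.restrict_apply hm, h, measure_empty, mul_zero, zero_add]
  refine (measure_mono (Set.inter_subset_left.trans Set.inter_subset_left)).trans ?_
  rw [Real.volume_Icc]
  refine ENNReal.ofReal_le_ofReal ?_
  linarith

theorem plantedLaw_singleton (δ x : ℝ) : plantedLaw δ {x} = 0 := by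
  simp [plantedLaw]

theorem tendsto_hasAllIn {ν : Measure ℝ} [IsProbabilityMeasure ν] {q C : ℝ} (hq₀ : 0 < q)
    (hq₁ : q < 1) (hC : 1 < C) {k : ℕ → ℕ} (hk : ∀ n, C * k₀ q n ≤ k n) {S : Set ℝ}
    (hS : ν S ≤ ENNReal.ofReal q) :
    Tendsto (fun n => Measure.pi (fun _ : Edge n => ν) (hasAllIn n (k n) S)) atTop (𝓝 0) :=
  tendsto_of_tendsto_of_tendsto_of_le_of_le tendsto_const_nhds
    (tendsto_first_moment hq₀ hq₁ hC hk) (fun _ => zero_le) fun n =>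
      (first_moment ν (k n) S).trans (by gcongr)

theorem tendsto_compl_hasAllIn {ν : Measure ℝ} [IsProbabilityMeasure ν] {p η : ℝ} (hp₀ : 0 < p)
    (hp₁ : p < 1) (hη₀ : 0 < η) (hη₁ : η < 1) {S : Set ℝ} (hS : MeasurableSet S)
    (hνS : ν S = ENNReal.ofReal p) :
    Tendsto (fun n => Measure.pi (fun _ : Edge n => ν) (hasAllIn n (lowerSize p η n) S)ᶜ) atTop
      (𝓝 0) := by
  have hlim := ENNReal.tendsto_ofReal (tendsto_second_moment hp₀ hp₁ hη₀ hη₁)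
  rw [ENNReal.ofReal_zero] at hlim
  refine tendsto_of_tendsto_of_tendsto_of_le_of_le' tendsto_const_nhds hlim
    (.of_forall fun _ => zero_le) ?_
  filter_upwards [eventually_lowerSize_le hp₀ hp₁ hη₀, eventually_gt_atTop 0] with n hk hn
  have hx : 1 ≤ (√p)⁻¹ := (one_le_inv₀ (Real.sqrt_pos.2 hp₀)).2 (Real.sqrt_le_one.2 hp₁.le)
  have hr : ν.real S * (√p)⁻¹ ^ 2 = 1 := by
    rw [measureReal_def, hνS, ENNReal.toReal_ofReal hp₀.le, inv_pow, Real.sq_sqrt hp₀.le,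
      mul_inv_cancel₀ hp₀.ne']
  have h := second_moment hn hk ν hS hx hr
  have hset : (hasAllIn n (lowerSize p η n) S)ᶜ =
      {lab | ∀ Q : Finset (Fin n), Q.card = lowerSize p η n → lab ∉ allIn (insideEdges Q) S} := by
    ext lab; simp [hasAllIn]
  rw [hset]
  exact ENNReal.le_ofReal_iff_toReal_le (measure_ne_top _ _) (measureReal_nonneg.trans h) |>.2 h

theorem pi_exists_eq_zero {ι : Type*} [Fintype ι] {ν : Measure ℝ} [IsProbabilityMeasure ν] {x : ℝ}
    (hx : ν {x} = 0) : Measure.pi (fun _ : ι => ν) {lab | ∃ e, lab e = x} = 0 := by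
  have h : {lab : ι → ℝ | ∃ e, lab e = x} = ⋃ e, Function.eval e ⁻¹' {x} := by
    ext lab; simp
  rw [h, measure_iUnion_null_iff]
  exact fun e => (Measure.quasiMeasurePreserving_eval _ e).preimage_null hx

theorem ae_tapeMeasure_mem_Icc : ∀ᵐ ω ∂tapeMeasure, ∀ k, ω k ∈ Set.Icc (0 : ℝ) 1 := by
  rw [ae_all_iff]
  intro k
  have h : ∀ᵐ x ∂uniform01, x ∈ Set.Icc (0 : ℝ) 1 := ae_restrict_mem measurableSet_Icc
  exact (measurePreserving_eval_infinitePi (fun _ : ℕ => uniform01) k).quasiMeasurePreserving.ae h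

/-- For small `η`, windows of non-edges are too short. -/
theorem exists_window_constant {δ : ℝ} (hδ₀ : 0 < δ) (hδ₁ : δ < 1) :
    ∃ η₀ : ℝ, 0 < η₀ ∧ η₀ ≤ 1 ∧ ∀ η < η₀, ∃ C : ℝ, 1 < C ∧
      ∀ n, C * k₀ (3 * δ / 4) n = (1 - η) * k₀ δ n := by
  have h1 : 0 < Real.log (1 / δ) := Real.log_pos (by rw [lt_div_iff₀ hδ₀]; linarith)
  have h2 : Real.log (1 / δ) < Real.log (1 / (3 * δ / 4)) := by
    refine Real.log_lt_log (by positivity) ?_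
    exact one_div_lt_one_div_of_lt (by positivity) (by linarith)
  set a := Real.log (1 / δ) with ha
  set b := Real.log (1 / (3 * δ / 4)) with hb
  have hb0 : 0 < b := h1.trans h2
  -- The ratio of `k₀ (3δ/4)` to `k₀ δ` is `a / b < 1`, so any `η` below `1 - a / b` leaves a
  -- constant `C > 1`.
  refine ⟨1 - a / b, ?_, ?_, fun η hη => ⟨(1 - η) * (b / a), ?_, fun n => ?_⟩⟩
  · rw [sub_pos, div_lt_one hb0]; exact h2
  · have : 0 < a / b := by positivity
    linarith
  · have h3 : a / b < 1 - η := by linarith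
    calc 1 = a / b * (b / a) := by field_simp
      _ < _ := by gcongr
  · simp only [k₀, ← ha, ← hb]
    field_simp

/-! ### The reduction -/

theorem graphReturns_plantProgram {n : ℕ} {δ : ℝ} {A : Program}
    {x : SimpleGraph (Fin n) × (ℕ → ℝ)} {Q : Finset (Fin n)}
    (h : TemporalReturns A (plantedInstance n δ x).1 (plantedInstance n δ x).2 Q) :
    GraphReturns ((plantProgram δ).seq A) x.1 x.2 Q := by
  obtain ⟨s, t, he, ho⟩ := h
  obtain ⟨t₀, -, he₀⟩ := plants_plantProgram δ n x.1 x.2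
  exact ⟨s, t₀ + t, .seq he₀ he, ho⟩

/-- The worst-case bound for `A` applies because planted labels and the remaining tape stay in `[0,
1]`. -/
theorem graphTime_plantProgram {δ : ℝ} (hδ₀ : 0 < δ) (hδ₁ : δ < 1) {A : Program} {T : ℕ → ℕ}
    (hT : TemporalTime A T) :
    GraphTime ((plantProgram δ).seq A) fun n => 30 * (n ^ 2 + 1) + T n := by
  intro n G ω hω
  obtain ⟨t₀, ht₀, he₀⟩ := plants_plantProgram δ n G ω
  obtain ⟨s, t, ht, he⟩ := hT n (plantedLabel δ G fun e => ω (edgeIndex e))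
    (fun k => ω (k + n.choose 2)) (fun e => plantedLabel_mem_Icc hδ₀ hδ₁ (hω _)) fun k => hω _
  exact ⟨s, t₀ + t, add_le_add ht₀ ht, .seq he₀ he⟩

theorem pi_plantedLaw_prod_tapeMeasure_le (n : ℕ) {δ : ℝ} (hδ₀ : 0 < δ) (hδ₁ : δ < 1)
    (S : Set ((Edge n → ℝ) × (ℕ → ℝ))) :
    ((Measure.pi fun _ : Edge n => plantedLaw δ).prod tapeMeasure) S ≤
      2 ^ n.choose 2 * ((labelMeasure n).prod tapeMeasure) S := by
  have := isProbabilityMeasure_plantedLaw hδ₀ hδ₁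
  have h := pi_le_pow_mul_pi (ι := Edge n) (μ := uniform01) (ν := plantedLaw δ) (c := 2)
    (plantedLaw_le hδ₀ hδ₁)
  rw [card_edge] at h
  have h2 := Measure.prod_mono h (le_refl tapeMeasure)
  rw [Measure.prod_smul_left] at h2
  exact h2 S

theorem findsCliqueWhp_plantProgram {δ : ℝ} (hδ₀ : 0 < δ) (hδ₁ : δ < 1) {A : Program}
    (hA : VeryLikelyApprox A (δ / 2)) :
    FindsCliqueWhp ((plantProgram δ).seq A) ⟨δ, hδ₀.le, hδ₁.le⟩ := by
  obtain ⟨ε, f, hε, hf, hfail⟩ := hA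
  obtain ⟨η₀, hη₀, hη₀1, hwin⟩ := exists_window_constant hδ₀ hδ₁
  have := isProbabilityMeasure_plantedLaw hδ₀ hδ₁
  set μ := fun n : ℕ =>
    (SimpleGraph.binomialRandom (Fin n) ⟨δ, hδ₀.le, hδ₁.le⟩).prod tapeMeasure with hμ
  refine exists_tendsto_zero_of_forall (F := fun η n => μ n {x | ¬ ∃ Q,
    GraphReturns ((plantProgram δ).seq A) x.1 x.2 Q ∧ x.1.IsClique (Q : Set (Fin n)) ∧
      |(Q.card : ℝ) - k₀ δ n| ≤ η * k₀ δ n}) hη₀ (fun η n => prob_le_one) fun η hη hηη₀ => ?_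
  obtain ⟨C, hC, hCk⟩ := hwin η hηη₀
  let P := fun n : ℕ => Measure.pi fun _ : Edge n => plantedLaw δ
  let bad := fun n : ℕ => {y : (Edge n → ℝ) × (ℕ → ℝ) |
    ¬ ∃ Q, TemporalReturns A y.1 y.2 Q ∧ IsApproxMax y.1 (δ / 2) (ε n) Q}
  let J := Finset.range (⌊4 / δ⌋₊ + 1)
  -- The exceptional labellings: too large a clique, no large clique, a large set of non-edges in
  -- one window, or a label exactly `δ/2`.
  let B := fun n : ℕ => hasAllIn n ⌈(1 + η) * k₀ δ n⌉₊ (Set.Icc 0 (δ / 2)) ∪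
    (hasAllIn n (lowerSize δ (η / 2) n) (Set.Icc 0 (δ / 2)))ᶜ ∪
    (⋃ j ∈ J, hasAllIn n ⌈(1 - η) * k₀ δ n⌉₊ (window δ j)) ∪ {lab | ∃ e, lab e = δ / 2}
  have hB : Tendsto (fun n => P n (B n)) atTop (𝓝 0) := by
    have hu : Tendsto (fun n => P n (hasAllIn n ⌈(1 + η) * k₀ δ n⌉₊ (Set.Icc 0 (δ / 2)))) atTop
        (𝓝 0) :=
      tendsto_hasAllIn hδ₀ hδ₁ (C := 1 + η) (by linarith) (fun n => Nat.le_ceil _)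
        (plantedLaw_Icc hδ₀).le
    have hl : Tendsto (fun n => P n (hasAllIn n (lowerSize δ (η / 2) n) (Set.Icc 0 (δ / 2)))ᶜ) atTop
        (𝓝 0) :=
      tendsto_compl_hasAllIn hδ₀ hδ₁ (by linarith) (by linarith) measurableSet_Icc (plantedLaw_Icc hδ₀)
    have hw : Tendsto (fun n => ∑ j ∈ J, P n (hasAllIn n ⌈(1 - η) * k₀ δ n⌉₊ (window δ j))) atTop
        (𝓝 0) := by
      rw [← Finset.sum_const_zero (s := J)]
      exact tendsto_finsetSum _ fun j _ => tendsto_hasAllIn (by positivity) (by linarith) hC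
        (fun n => (hCk n).trans_le (Nat.le_ceil _)) (plantedLaw_window_le hδ₀ j)
    have hsum := (hu.add hl).add hw
    simp only [add_zero] at hsum
    refine tendsto_of_tendsto_of_tendsto_of_le_of_le tendsto_const_nhds hsum (fun _ => zero_le)
      fun n => ?_
    refine (measure_union_le _ _).trans ?_
    have h0 : P n {lab | ∃ e, lab e = δ / 2} = 0 := pi_exists_eq_zero (plantedLaw_singleton _ _)
    rw [h0, add_zero]
    refine (measure_union_le _ _).trans (add_le_add (measure_union_le _ _) ?_)
    exact measure_biUnion_finset_le _ _
  have hbad : Tendsto (fun n => ((P n).prod tapeMeasure) (bad n)) atTop (𝓝 0) :=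
    tendsto_of_tendsto_of_tendsto_of_le_of_le tendsto_const_nhds (tendsto_two_pow_mul_exp_neg hf)
      (fun _ => zero_le) fun n => (pi_plantedLaw_prod_tapeMeasure_le n hδ₀ hδ₁ _).trans
        (mul_le_mul_right (hfail n) _)
  have hlim := hB.add hbad
  rw [add_zero] at hlim
  refine tendsto_of_tendsto_of_tendsto_of_le_of_le' tendsto_const_nhds hlim
    (.of_forall fun _ => zero_le) ?_
  have hε1 : ∀ᶠ n in atTop, 1 - η ≤ (1 - ε n) * (1 - η / 2) := by
    have h1 : Tendsto (fun n => (1 - ε n) * (1 - η / 2)) atTop (𝓝 ((1 - 0) * (1 - η / 2))) :=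
      (hε.const_sub 1).mul_const _
    exact (h1.eventually_const_lt (by linarith)).mono fun _ h => h.le
  filter_upwards [hε.eventually_le_const one_pos, hε1] with n hεn hεn'
  -- For a possibly non-measurable `S` only this inequality between preimage and pushforward is
  -- available, and it goes in the needed direction.
  have hmap : ∀ S, μ n (plantedInstance n δ ⁻¹' S) ≤ ((P n).prod tapeMeasure) S := fun S =>
    (Measure.le_map_apply (measurable_plantedInstance n δ).aemeasurable S).trans_eq
      (by rw [map_plantedInstance n hδ₀ hδ₁])
  have hae : μ n {x | ¬ ∀ k, x.2 k ∈ Set.Icc (0 : ℝ) 1} = 0 :=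
    Measure.quasiMeasurePreserving_snd.ae ae_tapeMeasure_mem_Icc
  calc _ ≤ μ n ({x | ¬ ∀ k, x.2 k ∈ Set.Icc (0 : ℝ) 1} ∪
        (plantedInstance n δ ⁻¹' (B n ×ˢ Set.univ) ∪ plantedInstance n δ ⁻¹' (bad n))) := by
        refine measure_mono fun x hx => ?_
        by_contra hcon
        simp only [Set.mem_union, not_or] at hcon
        obtain ⟨h1, h2, h3⟩ := hcon
        have hω : ∀ k, x.2 k ∈ Set.Icc (0 : ℝ) 1 := not_not.1 h1
        obtain ⟨Q, hQ, hmax⟩ := not_not.1 h3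
        have h4 : (plantedInstance n δ x).1 ∉ B n := fun h => h2 ⟨h, trivial⟩
        simp only [B, Set.mem_union, not_or, Set.mem_compl_iff, not_not, Set.mem_iUnion, not_exists,
          Set.mem_ofPred_eq] at h4
        obtain ⟨⟨⟨hu, hl⟩, hw⟩, hne⟩ := h4
        exact hx ⟨Q, graphReturns_plantProgram hQ,
          isClique_and_abs_card_sub_le hδ₀ hδ₁ (fun e => hω _) hne hεn hεn' hu hl hw hmax⟩
    _ ≤ P n (B n) + ((P n).prod tapeMeasure) (bad n) := by
        refine (measure_union_le _ _).trans ?_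
        rw [hae, zero_add]
        refine (measure_union_le _ _).trans (add_le_add ?_ (hmap _))
        refine (hmap _).trans_eq ?_
        rw [Measure.prod_prod, measure_univ, mul_one]

end TemporalClique

theorem theorem5 (δ : ℝ) (hδ₀ : 0 < δ) (hδ₁ : δ < 1) :
    ∃ (plant : RealRAM.Program) (C : ℕ),
      TemporalClique.Plants plant δ (fun n => C * (n ^ 2 + 1)) ∧
      ∀ A : ℝ → RealRAM.Program,
        (∀ δ' : ℝ, 0 < δ' → δ' < 1 → TemporalClique.VeryLikelyApprox (A δ') δ') →
          (∀ T : ℕ → ℕ, TemporalClique.TemporalTime (A (δ / 2)) T →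
            TemporalClique.GraphTime (plant.seq (A (δ / 2)))
              (fun n => C * (n ^ 2 + 1) + T n)) ∧
          TemporalClique.FindsCliqueWhp (plant.seq (A (δ / 2))) ⟨δ, hδ₀.le, hδ₁.le⟩ :=
  ⟨TemporalClique.plantProgram δ, 30, TemporalClique.plants_plantProgram δ, fun A hA =>
    ⟨fun _ hT => TemporalClique.graphTime_plantProgram hδ₀ hδ₁ hT,
      TemporalClique.findsCliqueWhp_plantProgram hδ₀ hδ₁
        (hA (δ / 2) (half_pos hδ₀) (by linarith))⟩⟩
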